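/- Let $\Omega=\,]a_1,c_1[\,\times\,]a_2,c_2[$ be an open rectangle, let $\omega=\,]\alpha_1,\beta_1[\,\times\,]\alpha_2,\beta_2[\ \subseteq\Omega$ with $\alpha_1<\beta_1$, $\alpha_2<\beta_2$ (the case $\omega=\Omega$ is allowed), and let $b=(b_1,b_2)\in\partial\Omega$. Consider the diffusion system $$\frac{\partial z}{\partial t}=\Delta z\ \text{ in }\Omega\times]0,\infty[,\qquad \frac{\partial z}{\partial\nu}=0\ \text{ on }\partial\Omega\times]0,\infty[,\qquad z(\cdot,0)=z_0\in H^1(\Omega),$$ with the boundary pointwise sensor at $b$, that is, with the output $y(t)=Cz(\cdot,t)=z(b,t)$, where $Cu=u(b)$ is the value at $b$ of the representative of $u$ that is continuous on $\overline\Omega$. For a gain $\mathcal H\in\mathcal L(\mathbb R,H^1(\Omega))$ consider the dynamical system $$\frac{\partial w}{\partial t}=\Delta w+\mathcal H\big(z(b,t)-w(b,t)\big)\ \text{ in }\Omega\times]0,\infty[,\qquad \frac{\partial w}{\partial\nu}=0\ \text{ on }\partial\Omega\times]0,\infty[,\qquad w(\cdot,0)=w_0\in H^1(\Omega).\tag{E}$$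 Solutions are continuous on $[0,\infty[$ with values in $H^1(\Omega)$, and for each $t>0$ they satisfy the equation with time derivative in $L^2(\Omega)$ and with $\Delta$ and the Neumann condition in the variational sense. Let $J$ be the number of unstable modes of the system, that is, the number of pairs $(i,j)$ of nonnegative integers with $\lambda_{ij}=-\pi^2\Big(\frac{i^2}{(c_1-a_1)^2}+\frac{j^2}{(c_2-a_2)^2}\Big)\ge 0$. Suppose that for all integers $i,j$ with $1\le i\le J$ and $1\le j\le J$ neither $$\frac{i\,(b_1-\alpha_1)}{\beta_1-\alpha_1}\qquad\text{nor}\qquad\frac{j\,(b_2-\alpha_2)}{\beta_2-\alpha_2}$$ is an even integer. Then the system is regionally exponentially observable in $\omega$ ($\omega_{E_C}$-observable) by the dynamical system (E): there is a gain $\mathcal H\in\mathcal L(\mathbb R,H^1(\Omega))$ such that 1. the operator $L=\Delta-\mathcal HC$ on $H^1(\Omega)$, with domain $D(L)$ the set of $u\in H^1(\Omega)$ that satisfy the homogeneous Neumann condition, have $\Delta u\in L^2(\Omega)$, have a value $u(b)$, and satisfy $\Delta u-\mathcal HCu\in H^1(\Omega)$, generates a strongly continuous semigroup on $H^1(\Omega)$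 that is exponentially stable, and the domain $D(\Delta)$ of the Neumann Laplacian in $H^1(\Omega)$ is contained in $D(L)$; 2. for every $z_0\in H^1(\Omega)$ the diffusion system has exactly one solution $z$, and for this $z$ and every $w_0\in H^1(\Omega)$ the system (E) has exactly one solution $w$; 3. there are constants $F,\sigma>0$ such that for all $z_0,w_0\in H^1(\Omega)$ and all $t\ge 0$ $$\|z(\cdot,t)|_\omega-w(\cdot,t)|_\omega\|_{H^1(\omega)}\le F\,e^{-\sigma t}\,\|z_0-w_0\|_{H^1(\Omega)} .$$ -/

import Mathlib

open Set Filter Topology MeasureTheory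

noncomputable section

namespace NeumannSensor

/-- The open rectangle `]a₁, c₁[ × ]a₂, c₂[`. -/
def rect (a₁ c₁ a₂ c₂ : ℝ) : Set (ℝ × ℝ) := Ioo a₁ c₁ ×ˢ Ioo a₂ c₂

/-- Real `L²(Ω)` for the Lebesgue measure. -/
abbrev L2 (Ω : Set (ℝ × ℝ)) : Type := Lp ℝ 2 ((volume : Measure (ℝ × ℝ)).restrict Ω)

/-- The partial derivative `∂φ/∂x_k` of a function on the plane. -/
def partialDeriv (k : Fin 2) (φ : ℝ × ℝ → ℝ) (x : ℝ × ℝ) : ℝ :=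
  fderiv ℝ φ x ((![((1 : ℝ), (0 : ℝ)), ((0 : ℝ), (1 : ℝ))] : Fin 2 → ℝ × ℝ) k)

/-- Test functions on `Ω`: smooth, with compact support inside `Ω`. -/
structure IsTest (Ω : Set (ℝ × ℝ)) (φ : ℝ × ℝ → ℝ) : Prop where
  smooth : ContDiff ℝ ((⊤ : ℕ∞) : WithTop ℕ∞) φ
  compact : HasCompactSupport φ
  support : tsupport φ ⊆ Ω

/-- `g` is the weak derivative of `u` in the direction `x_k` on `Ω`. -/
def IsWeakPartial {Ω : Set (ℝ × ℝ)} (k : Fin 2) (u g : L2 Ω) : Prop :=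
  ∀ φ : ℝ × ℝ → ℝ, IsTest Ω φ →
    ∫ x in Ω, u x * partialDeriv k φ x = - ∫ x in Ω, g x * φ x

theorem IsTest.continuous_partialDeriv {Ω : Set (ℝ × ℝ)} {φ : ℝ × ℝ → ℝ} (hφ : IsTest Ω φ)
    (k : Fin 2) : Continuous (partialDeriv k φ) :=
  (hφ.smooth.continuous_fderiv (by simp)).clm_apply continuous_const

theorem IsTest.compact_partialDeriv {Ω : Set (ℝ × ℝ)} {φ : ℝ × ℝ → ℝ} (hφ : IsTest Ω φ)
    (k : Fin 2) : HasCompactSupport (partialDeriv k φ) :=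
  hφ.compact.fderiv_apply ℝ _

theorem integrable_mul_test {Ω : Set (ℝ × ℝ)} (u : L2 Ω) {ψ : ℝ × ℝ → ℝ}
    (hc : Continuous ψ) (hs : HasCompactSupport ψ) :
    Integrable (fun x => u x * ψ x) ((volume : Measure (ℝ × ℝ)).restrict Ω) :=
  (Lp.memLp u).integrable_mul (q := 2) ((hc.memLp_of_hasCompactSupport hs).restrict Ω)

theorem IsWeakPartial.add {Ω : Set (ℝ × ℝ)} {k : Fin 2} {u g u' g' : L2 Ω}
    (h : IsWeakPartial k u g) (h' : IsWeakPartial k u' g') :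
    IsWeakPartial k (u + u') (g + g') := by
  intro φ hφ
  have e1 : ∫ x in Ω, (u + u') x * partialDeriv k φ x
      = ∫ x in Ω, (u x * partialDeriv k φ x + u' x * partialDeriv k φ x) := by
    apply integral_congr_ae
    filter_upwards [Lp.coeFn_add u u'] with x hx
    rw [hx, Pi.add_apply, add_mul]
  have e2 : ∫ x in Ω, (g + g') x * φ x = ∫ x in Ω, (g x * φ x + g' x * φ x) := by
    apply integral_congr_ae
    filter_upwards [Lp.coeFn_add g g'] with x hx
    rw [hx, Pi.add_apply, add_mul]
  rw [e1, e2, integral_add, integral_add, h φ hφ, h' φ hφ]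
  · ring
  · exact integrable_mul_test g hφ.smooth.continuous hφ.compact
  · exact integrable_mul_test g' hφ.smooth.continuous hφ.compact
  · exact integrable_mul_test u (hφ.continuous_partialDeriv k) (hφ.compact_partialDeriv k)
  · exact integrable_mul_test u' (hφ.continuous_partialDeriv k) (hφ.compact_partialDeriv k)

theorem IsWeakPartial.smul {Ω : Set (ℝ × ℝ)} {k : Fin 2} {u g : L2 Ω} (r : ℝ)
    (h : IsWeakPartial k u g) : IsWeakPartial k (r • u) (r • g) := by
  intro φ hφ
  have e1 : ∫ x in Ω, (r • u) x * partialDeriv k φ x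
      = ∫ x in Ω, r * (u x * partialDeriv k φ x) := by
    apply integral_congr_ae
    filter_upwards [Lp.coeFn_smul r u] with x hx
    rw [hx, Pi.smul_apply, smul_eq_mul, mul_assoc]
  have e2 : ∫ x in Ω, (r • g) x * φ x = ∫ x in Ω, r * (g x * φ x) := by
    apply integral_congr_ae
    filter_upwards [Lp.coeFn_smul r g] with x hx
    rw [hx, Pi.smul_apply, smul_eq_mul, mul_assoc]
  rw [e1, e2, integral_const_mul, integral_const_mul, h φ hφ, mul_neg]

theorem IsWeakPartial.zero {Ω : Set (ℝ × ℝ)} {k : Fin 2} :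
    IsWeakPartial k (0 : L2 Ω) (0 : L2 Ω) := by
  intro φ hφ
  have e1 : ∫ x in Ω, (0 : L2 Ω) x * partialDeriv k φ x = 0 := by
    apply integral_eq_zero_of_ae
    filter_upwards [Lp.coeFn_zero ℝ 2 ((volume : Measure (ℝ × ℝ)).restrict Ω)] with x hx
    rw [hx]; simp
  have e2 : ∫ x in Ω, (0 : L2 Ω) x * φ x = 0 := by
    apply integral_eq_zero_of_ae
    filter_upwards [Lp.coeFn_zero ℝ 2 ((volume : Measure (ℝ × ℝ)).restrict Ω)] with x hx
    rw [hx]; simp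
  rw [e1, e2, neg_zero]

/-- The Sobolev space `H¹(Ω)`: triples `(u, ∂₁u, ∂₂u)` in `L²(Ω)³` whose last two entries are the
weak partial derivatives of the first. The inherited Hilbert norm is the usual one,
`‖u‖² = ‖u‖²_{L²} + ‖∂₁u‖²_{L²} + ‖∂₂u‖²_{L²}`. -/
def H1 (Ω : Set (ℝ × ℝ)) : Submodule ℝ (PiLp 2 (fun _ : Fin 3 => L2 Ω)) where
  carrier := {U | ∀ k : Fin 2, IsWeakPartial k (U 0) (U k.succ)}
  add_mem' := fun h h' k => (h k).add (h' k)
  zero_mem' := fun _ => IsWeakPartial.zero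
  smul_mem' := fun r _ h k => (h k).smul r

/-- The underlying `L²` function of an element of `H¹(Ω)`. -/
def toL2 {Ω : Set (ℝ × ℝ)} (U : H1 Ω) : L2 Ω := (U : PiLp 2 (fun _ : Fin 3 => L2 Ω)) 0

/-- The `k`-th component of the weak gradient of an element of `H¹(Ω)`. -/
def weakGrad {Ω : Set (ℝ × ℝ)} (U : H1 Ω) (k : Fin 2) : L2 Ω :=
  (U : PiLp 2 (fun _ : Fin 3 => L2 Ω)) k.succ

/-- Restriction `L²(Ω) → L²(ω)` for `ω ⊆ Ω`. -/
def restrictL2 {ω Ω : Set (ℝ × ℝ)} (h : ω ⊆ Ω) (u : L2 Ω) : L2 ω :=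
  ((Lp.memLp u).mono_measure (Measure.restrict_mono h le_rfl)).toLp u

theorem restrictL2_ae {ω Ω : Set (ℝ × ℝ)} (h : ω ⊆ Ω) (u : L2 Ω) :
    restrictL2 h u =ᵐ[(volume : Measure (ℝ × ℝ)).restrict ω] u :=
  MemLp.coeFn_toLp _

theorem integral_restrictL2_mul {ω Ω : Set (ℝ × ℝ)} (h : ω ⊆ Ω) (u : L2 Ω) {ψ : ℝ × ℝ → ℝ}
    (hψ : ∀ x, x ∉ ω → ψ x = 0) :
    ∫ x in ω, restrictL2 h u x * ψ x = ∫ x in Ω, u x * ψ x := by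
  have e1 : ∫ x in ω, restrictL2 h u x * ψ x = ∫ x in ω, u x * ψ x := by
    apply integral_congr_ae
    filter_upwards [restrictL2_ae h u] with x hx
    rw [hx]
  rw [e1, setIntegral_eq_integral_of_forall_compl_eq_zero,
    setIntegral_eq_integral_of_forall_compl_eq_zero]
  · intro x hx
    rw [hψ x (fun h' => hx (h h')), mul_zero]
  · intro x hx
    rw [hψ x hx, mul_zero]

/-- The restriction operator `χ_ω : H¹(Ω) → H¹(ω)`. -/
def restrictH1 {ω Ω : Set (ℝ × ℝ)} (h : ω ⊆ Ω) (U : H1 Ω) : H1 ω :=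
  ⟨WithLp.toLp 2 (fun k => restrictL2 h ((U : PiLp 2 (fun _ : Fin 3 => L2 Ω)) k)), by
    intro k φ hφ
    have h0 : ∀ x, x ∉ ω → φ x = 0 := fun x hx =>
      image_eq_zero_of_notMem_tsupport (fun h' => hx (hφ.support h'))
    have h1 : ∀ x, x ∉ ω → partialDeriv k φ x = 0 := by
      intro x hx
      have : fderiv ℝ φ x = 0 := by
        apply image_eq_zero_of_notMem_tsupport
        exact fun h' => hx (hφ.support (tsupport_fderiv_subset ℝ h'))
      simp [partialDeriv, this]
    change ∫ x in ω, restrictL2 h _ x * _ = - ∫ x in ω, restrictL2 h _ x * _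
    rw [integral_restrictL2_mul h _ h1, integral_restrictL2_mul h _ h0]
    exact U.2 k φ ⟨hφ.smooth, hφ.compact, hφ.support.trans h⟩⟩

/-- `U ∈ H¹(Ω)` satisfies `ΔU = v` in `Ω` and `∂U/∂ν = 0` on `∂Ω`, in the variational sense:
`∫_Ω ∇U · ∇Φ = - ∫_Ω v Φ` for every `Φ ∈ H¹(Ω)`. -/
def IsNeumannLaplacian {Ω : Set (ℝ × ℝ)} (U : H1 Ω) (v : L2 Ω) : Prop :=
  ∀ Φ : H1 Ω, ∑ k : Fin 2, inner ℝ (weakGrad U k) (weakGrad Φ k) = - inner ℝ v (toL2 Φ)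

/-- The pointwise sensor at `b`: `u` has a representative that is continuous up to the boundary
of `Ω`, and its value at `b` is `y`. -/
def HasPointValue {Ω : Set (ℝ × ℝ)} (u : L2 Ω) (b : ℝ × ℝ) (y : ℝ) : Prop :=
  ∃ g : ℝ × ℝ → ℝ, ContinuousOn g (closure Ω) ∧
    u =ᵐ[(volume : Measure (ℝ × ℝ)).restrict Ω] g ∧ g b = y

/-- The graph of the Neumann Laplacian as an operator in the state space `H¹(Ω)`. -/
def laplacianGraph {Ω : Set (ℝ × ℝ)} (U V : H1 Ω) : Prop :=
  IsNeumannLaplacian U (toL2 V)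

/-- The graph in `H¹(Ω)` of the operator `L = Δ - H C` of the estimator, where `C u = u(b)`. -/
def estimatorGraph {Ω : Set (ℝ × ℝ)} (b : ℝ × ℝ) (H : ℝ →L[ℝ] H1 Ω) (U V : H1 Ω) : Prop :=
  ∃ (v : L2 Ω) (c : ℝ), IsNeumannLaplacian U v ∧ HasPointValue (toL2 U) b c ∧ toL2 V = v - toL2 (H c)

/-- A family `S t`, `t ≥ 0`, of bounded operators is a strongly continuous semigroup. -/
structure IsC0Semigroup {X : Type*} [NormedAddCommGroup X] [NormedSpace ℝ X]
    (S : ℝ → X →L[ℝ] X) : Prop where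
  zero : S 0 = ContinuousLinearMap.id ℝ X
  add : ∀ s t : ℝ, 0 ≤ s → 0 ≤ t → S (s + t) = (S s).comp (S t)
  strong : ∀ x : X, Tendsto (fun t => S t x) (𝓝[>] 0) (𝓝 x)

/-- The operator with graph `A` (with its exact domain) is the generator of `S`. -/
def IsGeneratedBy {X : Type*} [NormedAddCommGroup X] [NormedSpace ℝ X]
    (A : X → X → Prop) (S : ℝ → X →L[ℝ] X) : Prop :=
  ∀ x y : X, A x y ↔ Tendsto (fun t : ℝ => t⁻¹ • (S t x - x)) (𝓝[>] 0) (𝓝 y)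

/-- Exponential stability of a semigroup. -/
def IsExpStable {X : Type*} [NormedAddCommGroup X] [NormedSpace ℝ X]
    (S : ℝ → X →L[ℝ] X) : Prop :=
  ∃ F σ : ℝ, 0 < F ∧ 0 < σ ∧ ∀ t : ℝ, 0 ≤ t → ‖S t‖ ≤ F * Real.exp (-σ * t)

/-- `z` solves `∂z/∂t = Δz` in `Ω × ]0, ∞[`, `∂z/∂ν = 0` on `∂Ω × ]0, ∞[`, `z(0) = z₀`:
`z` is continuous on `[0, ∞[` with values in `H¹(Ω)`, and the equation holds at each time `t > 0`,
with the time derivative taken in `L²(Ω)`. -/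
structure IsSystemSolution {Ω : Set (ℝ × ℝ)} (z₀ : H1 Ω) (z : ℝ → H1 Ω) : Prop where
  cont : ContinuousOn z (Ici 0)
  init : z 0 = z₀
  eqn : ∀ t : ℝ, 0 < t → ∃ v : L2 Ω, IsNeumannLaplacian (z t) v ∧
    HasDerivAt (fun s => toL2 (z s)) v t

/-- `w` solves the estimator driven by the output `y(t) = z(b, t)` of the state `z`:
`∂w/∂t = Δw + H (z(b, t) - w(b, t))` in `Ω × ]0, ∞[`, `∂w/∂ν = 0` on `∂Ω × ]0, ∞[`,
`w(0) = w₀`. -/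
structure IsEstimatorSolution {Ω : Set (ℝ × ℝ)} (b : ℝ × ℝ) (H : ℝ →L[ℝ] H1 Ω)
    (z : ℝ → H1 Ω) (w₀ : H1 Ω) (w : ℝ → H1 Ω) : Prop where
  cont : ContinuousOn w (Ici 0)
  init : w 0 = w₀
  eqn : ∀ t : ℝ, 0 < t → ∃ (v : L2 Ω) (y c : ℝ), IsNeumannLaplacian (w t) v ∧
    HasPointValue (toL2 (z t)) b y ∧ HasPointValue (toL2 (w t)) b c ∧
    HasDerivAt (fun s => toL2 (w s)) (v + toL2 (H (y - c))) t

/-- The estimator with gain `H` and the sensor at `b` is an `ω_{E_C}`-estimator of the state `z`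
on `ω` (for the operator `T = id`, with estimator space `W = H¹(Ω)`). -/
structure IsRegionalExpEstimator {ω Ω : Set (ℝ × ℝ)} (hω : ω ⊆ Ω) (b : ℝ × ℝ)
    (H : ℝ →L[ℝ] H1 Ω) : Prop where
  /-- `L = Δ - H C` generates an exponentially stable strongly continuous semigroup. -/
  stable : ∃ S : ℝ → H1 Ω →L[ℝ] H1 Ω, IsC0Semigroup S ∧
    IsGeneratedBy (estimatorGraph b H) S ∧ IsExpStable S
  /-- `D(Δ)` is contained in `D(L)`. -/
  domain : ∀ U V : H1 Ω, laplacianGraph U V → ∃ V' : H1 Ω, estimatorGraph b H U V'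
  /-- The system has exactly one solution for every initial state. -/
  system_wellPosed : ∀ z₀ : H1 Ω, ∃ z : ℝ → H1 Ω, IsSystemSolution z₀ z ∧
    ∀ z' : ℝ → H1 Ω, IsSystemSolution z₀ z' → EqOn z' z (Ici 0)
  /-- For every state of the system, the estimator has exactly one solution for every
  initial state. -/
  estimator_wellPosed : ∀ (z₀ : H1 Ω) (z : ℝ → H1 Ω), IsSystemSolution z₀ z →
    ∀ w₀ : H1 Ω, ∃ w : ℝ → H1 Ω, IsEstimatorSolution b H z w₀ w ∧
      ∀ w' : ℝ → H1 Ω, IsEstimatorSolution b H z w₀ w' → EqOn w' w (Ici 0)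
  /-- The estimation error decays exponentially in `H¹(ω)`, uniformly in the initial states. -/
  error : ∃ F σ : ℝ, 0 < F ∧ 0 < σ ∧
    ∀ (z₀ w₀ : H1 Ω) (z w : ℝ → H1 Ω), IsSystemSolution z₀ z → IsEstimatorSolution b H z w₀ w →
      ∀ t : ℝ, 0 ≤ t →
        ‖restrictH1 hω (z t) - restrictH1 hω (w t)‖ ≤ F * Real.exp (-σ * t) * ‖z₀ - w₀‖

/-- The system with the pointwise sensor at `b` is `ω_{E_C}`-observable by the estimator
`∂w/∂t = Δw + H (z(b, t) - w(b, t))`, for a suitable gain `H`. -/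
def IsRegionalExpObservable {ω Ω : Set (ℝ × ℝ)} (hω : ω ⊆ Ω) (b : ℝ × ℝ) : Prop :=
  ∃ H : ℝ →L[ℝ] H1 Ω, IsRegionalExpEstimator hω b H

/-- The Neumann eigenvalues of the Laplacian on a rectangle with side lengths `l₁`, `l₂`. -/
def neumannEigenvalue (l₁ l₂ : ℝ) (i j : ℕ) : ℝ :=
  -((i : ℝ) ^ 2 / l₁ ^ 2 + (j : ℝ) ^ 2 / l₂ ^ 2) * Real.pi ^ 2

/-- The number of unstable modes, i.e. of pairs `(i, j)` with a nonnegative eigenvalue. -/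
def unstableModes (l₁ l₂ : ℝ) : ℕ :=
  {p : ℕ × ℕ | 0 ≤ neumannEigenvalue l₁ l₂ p.1 p.2}.ncard

/-- The real number `x` is an even integer. -/
def IsEvenInteger (x : ℝ) : Prop := ∃ m : ℤ, Even m ∧ x = m

end NeumannSensor

end

/-! The Neumann Laplacian on a rectangle is diagonal in products of cosines. Its only nonnegative
eigenvalue is 0, and the eigenspace consists of the constants. The constant mode e₀ does not vanish
at `b`, so the sensor sees the one mode that has to be stabilised, and injecting the output along
that mode suffices: the gain is r ↦ γ r e₀ with γ e₀(b) = `gap`, half of the smallest positive decay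
rate.

The error ε = z − w then obeys ε' = Δε − γ ε(b) e₀. In modal coordinates this is triangular: the
stable modes evolve freely and only feed the constant mode through their values at `b`. The shear x
↦ x − φ(x) e₀ with φ(e₀) = 0 and φ(eᵢ) = γ eᵢ(b) / (rateᵢ − gap) makes the operator diagonal, with
the rate 0 replaced by `gap` (`estimatorGenerates_iff`). Point evaluation is not bounded on H¹, but
φ is bounded even on L², because the modes are uniformly bounded and ∑ (1 + rate)⁻² converges in
dimension two. Hence Δ − 𝓗C is conjugate, by a bounded isomorphism of H¹, to a diagonal operator
with rates at least `gap`. Generation with the exact domain and exponential stability are read off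
the coordinates (`isGeneratedBy_estimatorFlow`, `isExpStable_estimatorFlow`), and solutions are
unique because each coordinate solves a scalar linear equation.

The analysis on the rectangle supplies the modal picture. The cosines are complete in L² by
Stone–Weierstrass and, rescaled, form a Hilbert basis of H¹; the variational Laplacian multiplies
coefficients by −rate (`isNeumannLaplacian_iff`); states with Laplacian in L² have absolutely
summable coefficients, so their value at `b` is the sum of the series (`hasPointValue_of_summable`).
The estimate on the subregion follows from the global one, since restriction does not increase the
norm. -/

noncomputable section

namespace NeumannSensor

/-! ### Diagonal operators and semigroups in a Hilbert basis -/

section HilbertBasis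

variable {ι E : Type*} [NormedAddCommGroup E] [InnerProductSpace ℝ E]

/-- The `i`-th coordinate in a Hilbert basis, as a bounded functional. -/
def coord (b : HilbertBasis ι ℝ E) (i : ι) : E →L[ℝ] ℝ := innerSL ℝ (b i)

theorem coord_apply (b : HilbertBasis ι ℝ E) (i : ι) (x : E) : coord b i x = inner ℝ (b i) x := rfl

theorem coord_eq_repr (b : HilbertBasis ι ℝ E) (i : ι) (x : E) : coord b i x = b.repr x i :=
  (b.repr_apply_apply x i).symm

theorem hasSum_repr_sq (b : HilbertBasis ι ℝ E) (x : E) :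
    HasSum (fun i => coord b i x ^ 2) (‖x‖ ^ 2) := by
  have h := b.hasSum_inner_mul_inner x x
  rw [real_inner_self_eq_norm_sq] at h
  refine h.congr_fun fun i => ?_
  rw [coord_apply, real_inner_comm x, sq]

theorem repr_ext (b : HilbertBasis ι ℝ E) {x y : E} (h : ∀ i, coord b i x = coord b i y) : x = y :=
  b.repr.injective (lp.ext (funext fun i => by
    rw [← coord_eq_repr, ← coord_eq_repr, h i]))

theorem exists_repr_eq (b : HilbertBasis ι ℝ E) {c : ι → ℝ} (hc : Summable fun i => c i ^ 2) :
    ∃ x, ∀ i, coord b i x = c i := by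
  have hm : Memℓp c 2 := by
    apply memℓp_gen
    simpa using hc
  exact ⟨b.repr.symm ⟨c, hm⟩, fun i => by
    rw [coord_eq_repr, LinearIsometryEquiv.apply_symm_apply]⟩

theorem norm_le_of_abs_repr_le (b : HilbertBasis ι ℝ E) {x y : E} {M : ℝ} (hM : 0 ≤ M)
    (h : ∀ i, |coord b i x| ≤ M * |coord b i y|) : ‖x‖ ≤ M * ‖y‖ := by
  have h1 : ‖x‖ ^ 2 ≤ M ^ 2 * ‖y‖ ^ 2 := by
    refine hasSum_le (fun i => ?_) (hasSum_repr_sq b x) ((hasSum_repr_sq b y).mul_left (M ^ 2))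
    rw [← sq_abs (coord b i x), ← sq_abs (coord b i y), ← mul_pow]
    exact pow_le_pow_left₀ (abs_nonneg _) (h i) 2
  rw [← mul_pow] at h1
  exact le_of_sq_le_sq h1 (by positivity)

/-- Parseval turns the norm of the difference into a sum of squares, to which dominated convergence
for series applies. -/
theorem tendsto_of_repr {α : Type*} {F : Filter α} (b : HilbertBasis ι ℝ E) {y : α → E} {x : E}
    {g : ι → ℝ} (hg : Summable fun i => g i ^ 2)
    (hbd : ∀ᶠ a in F, ∀ i, |coord b i (y a) - coord b i x| ≤ g i)
    (hlim : ∀ i, Tendsto (fun a => coord b i (y a)) F (𝓝 (coord b i x))) : Tendsto y F (𝓝 x) := by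
  rw [tendsto_iff_norm_sub_tendsto_zero]
  have key : Tendsto (fun a => ∑' i, (coord b i (y a) - coord b i x) ^ 2) F (𝓝 (∑' _ : ι, (0 : ℝ))) := by
    refine tendsto_tsum_of_dominated_convergence hg (fun i => ?_) ?_
    · have := ((hlim i).sub_const (coord b i x)).pow 2
      simpa using this
    · filter_upwards [hbd] with a ha i
      rw [Real.norm_eq_abs, abs_pow]
      exact pow_le_pow_left₀ (abs_nonneg _) (ha i) 2
  rw [tsum_zero] at key
  have h2 := key.sqrt
  rw [Real.sqrt_zero] at h2
  refine h2.congr fun a => ?_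
  have h3 := (hasSum_repr_sq b (y a - x)).tsum_eq
  simp only [map_sub] at h3
  rw [h3, Real.sqrt_sq (norm_nonneg _)]

/-- The operator that multiplies the `i`-th coordinate by `m i`. -/
def diagOp (b : HilbertBasis ι ℝ E) (m : ι → ℝ) (M : ℝ) (hM : ∀ i, |m i| ≤ M) : E →L[ℝ] E :=
  have hs : ∀ x : E, Summable fun i => (m i * coord b i x) ^ 2 := fun x => by
    refine Summable.of_nonneg_of_le (fun i => sq_nonneg _) (fun i => ?_)
      ((hasSum_repr_sq b x).summable.mul_left (M ^ 2))
    rw [mul_pow, ← sq_abs (m i)]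
    exact mul_le_mul_of_nonneg_right (pow_le_pow_left₀ (abs_nonneg _) (hM i) 2) (sq_nonneg _)
  have hc : ∀ x i, coord b i (exists_repr_eq b (hs x)).choose = m i * coord b i x :=
    fun x => (exists_repr_eq b (hs x)).choose_spec
  LinearMap.mkContinuous
    { toFun := fun x => (exists_repr_eq b (hs x)).choose
      map_add' := fun x y => repr_ext b fun i => by
        rw [map_add, hc, hc, hc, ← mul_add, ← map_add]
      map_smul' := fun r x => repr_ext b fun i => by
        rw [map_smul, hc, hc, map_smul, smul_eq_mul, smul_eq_mul, RingHom.id_apply, mul_left_comm] } (max M 0) fun x => norm_le_of_abs_repr_le b (le_max_right _ _) fun i => by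
          change |coord b i (exists_repr_eq b (hs x)).choose| ≤ _
          rw [hc, abs_mul]
          exact mul_le_mul_of_nonneg_right ((hM i).trans (le_max_left _ _)) (abs_nonneg _)

@[simp]
theorem repr_diagOp (b : HilbertBasis ι ℝ E) (m : ι → ℝ) (M : ℝ) (hM : ∀ i, |m i| ≤ M) (x : E)
    (i : ι) : coord b i (diagOp b m M hM x) = m i * coord b i x := by
  have hs : Summable fun i => (m i * coord b i x) ^ 2 := by
    refine Summable.of_nonneg_of_le (fun i => sq_nonneg _) (fun i => ?_)
      ((hasSum_repr_sq b x).summable.mul_left (M ^ 2))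
    rw [mul_pow, ← sq_abs (m i)]
    exact mul_le_mul_of_nonneg_right (pow_le_pow_left₀ (abs_nonneg _) (hM i) 2) (sq_nonneg _)
  exact (exists_repr_eq b hs).choose_spec i

theorem abs_exp_neg_mul_max_le {ν : ι → ℝ} (hν : ∀ i, 0 ≤ ν i) (t : ℝ) (i : ι) :
    |Real.exp (-ν i * max t 0)| ≤ 1 := by
  rw [Real.abs_exp, Real.exp_le_one_iff]
  have := mul_nonneg (hν i) (le_max_right t 0)
  linarith

/-- The diagonal semigroup with decay rates `ν i ≥ 0` (constant for negative times). -/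
def expDiag (b : HilbertBasis ι ℝ E) (ν : ι → ℝ) (hν : ∀ i, 0 ≤ ν i) (t : ℝ) : E →L[ℝ] E :=
  diagOp b (fun i => Real.exp (-ν i * max t 0)) 1 (abs_exp_neg_mul_max_le hν t)

variable (b : HilbertBasis ι ℝ E) {ν : ι → ℝ} (hν : ∀ i, 0 ≤ ν i)

theorem repr_expDiag {t : ℝ} (ht : 0 ≤ t) (x : E) (i : ι) :
    coord b i (expDiag b ν hν t x) = Real.exp (-ν i * t) * coord b i x := by
  rw [expDiag, repr_diagOp, max_eq_left ht]

theorem repr_expDiag_max (t : ℝ) (x : E) (i : ι) :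
    coord b i (expDiag b ν hν t x) = Real.exp (-ν i * max t 0) * coord b i x := by
  rw [expDiag, repr_diagOp]

theorem norm_expDiag_le {k : ℝ} (hk : ∀ i, k ≤ ν i) {t : ℝ} (ht : 0 ≤ t) :
    ‖expDiag b ν hν t‖ ≤ Real.exp (-k * t) := by
  refine ContinuousLinearMap.opNorm_le_bound _ (Real.exp_nonneg _) fun x => ?_
  refine norm_le_of_abs_repr_le b (Real.exp_nonneg _) fun i => ?_
  rw [repr_expDiag b hν ht, abs_mul, Real.abs_exp]
  refine mul_le_mul_of_nonneg_right (Real.exp_le_exp.2 ?_) (abs_nonneg _)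
  have := mul_le_mul_of_nonneg_right (hk i) ht
  linarith

theorem continuous_expDiag (x : E) : Continuous fun t => expDiag b ν hν t x := by
  rw [continuous_iff_continuousAt]
  intro t
  have hg : Summable fun i => (2 * coord b i x) ^ 2 := by
    simp only [mul_pow]
    exact (hasSum_repr_sq b x).summable.mul_left _
  have hg' : Summable fun i => (2 * |coord b i x|) ^ 2 := by
    simpa only [mul_pow, sq_abs] using hg
  refine tendsto_of_repr b hg' (Eventually.of_forall fun s i => ?_) fun i => ?_
  · rw [repr_expDiag_max, repr_expDiag_max, ← sub_mul, abs_mul]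
    refine mul_le_mul_of_nonneg_right ?_ (abs_nonneg _)
    have h1 := abs_exp_neg_mul_max_le hν s i
    have h2 := abs_exp_neg_mul_max_le hν t i
    exact (abs_sub _ _).trans (by linarith)
  · simp only [repr_expDiag_max]
    have : Continuous fun s => Real.exp (-ν i * max s 0) * coord b i x := by fun_prop
    exact this.tendsto t

theorem isC0Semigroup_expDiag : IsC0Semigroup (expDiag b ν hν) where
  zero := by
    ext x
    refine repr_ext b fun i => ?_
    rw [repr_expDiag b hν le_rfl]
    simp
  add s t hs ht := by
    ext x
    refine repr_ext b fun i => ?_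
    rw [ContinuousLinearMap.comp_apply, repr_expDiag b hν (add_nonneg hs ht),
      repr_expDiag b hν hs, repr_expDiag b hν ht, ← mul_assoc, ← Real.exp_add]
    ring_nf
  strong x := by
    have h := (continuous_expDiag b hν x).tendsto 0
    have h0 : expDiag b ν hν 0 x = x := by
      refine repr_ext b fun i => ?_
      rw [repr_expDiag b hν le_rfl]
      simp
    rw [h0] at h
    exact h.mono_left nhdsWithin_le_nhds

theorem hasDerivAt_exp_neg_mul (a t : ℝ) :
    HasDerivAt (fun s => Real.exp (-a * s)) (-a * Real.exp (-a * t)) t := by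
  have := ((hasDerivAt_id t).const_mul (-a)).exp
  simpa [mul_comm] using this

theorem abs_slope_exp_le {a : ℝ} (ha : 0 ≤ a) {t : ℝ} (ht : 0 < t) :
    |t⁻¹ * (Real.exp (-a * t) - 1)| ≤ a := by
  have h1 : Real.exp (-a * t) ≤ 1 := Real.exp_le_one_iff.2 (by nlinarith)
  have h2 := Real.add_one_le_exp (-a * t)
  rw [abs_mul, abs_of_pos (inv_pos.2 ht), abs_of_nonpos (by linarith), inv_mul_le_iff₀ ht]
  linarith

/-- The limit is forced coordinate by coordinate. Conversely, 1 − exp(−νt) ≤ νt bounds each slope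
coordinate by that of `y`, so the existence of `y` alone gives the domination; this yields the
generator with its exact domain. -/
theorem tendsto_slope_expDiag_iff (x y : E) :
    Tendsto (fun t : ℝ => t⁻¹ • (expDiag b ν hν t x - x)) (𝓝[>] 0) (𝓝 y) ↔
      ∀ i, coord b i y = -ν i * coord b i x := by
  have hc : ∀ t : ℝ, 0 < t → ∀ i, coord b i (t⁻¹ • (expDiag b ν hν t x - x))
      = t⁻¹ * (Real.exp (-ν i * t) - 1) * coord b i x := by
    intro t ht i
    rw [map_smul, map_sub, repr_expDiag b hν ht.le, smul_eq_mul]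
    ring
  have hlim : ∀ i, Tendsto (fun t : ℝ => coord b i (t⁻¹ • (expDiag b ν hν t x - x))) (𝓝[>] 0)
      (𝓝 (-ν i * coord b i x)) := by
    intro i
    have h1 : HasDerivAt (fun s => Real.exp (-ν i * s)) (-ν i) 0 := by
      simpa using hasDerivAt_exp_neg_mul (ν i) 0
    have h2 := (hasDerivAt_iff_tendsto_slope.1 h1).mono_left
      (nhdsWithin_mono 0 (fun s (hs : 0 < s) => hs.ne'))
    refine (h2.mul_const (coord b i x)).congr' ?_
    filter_upwards [self_mem_nhdsWithin] with t ht
    rw [hc t ht, slope_def_field]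
    rw [sub_zero, mul_zero, Real.exp_zero, div_eq_inv_mul]
  constructor
  · intro h i
    have h1 : Tendsto (fun t : ℝ => coord b i (t⁻¹ • (expDiag b ν hν t x - x))) (𝓝[>] 0)
        (𝓝 (coord b i y)) := by
      exact ((coord b i).continuous.tendsto y).comp h
    exact tendsto_nhds_unique h1 (hlim i)
  · intro h
    have hg : Summable fun i => (2 * |coord b i y|) ^ 2 := by
      simp only [mul_pow, sq_abs]
      exact (hasSum_repr_sq b y).summable.mul_left _
    refine tendsto_of_repr b hg ?_ fun i => by rw [h i]; exact hlim i
    filter_upwards [self_mem_nhdsWithin] with t ht i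
    have h1 : |coord b i (t⁻¹ • (expDiag b ν hν t x - x))| ≤ |coord b i y| := by
      rw [hc t ht, h i, abs_mul, abs_mul (-ν i), abs_neg, abs_of_nonneg (hν i)]
      exact mul_le_mul_of_nonneg_right (abs_slope_exp_le (hν i) ht) (abs_nonneg _)
    exact (abs_sub _ _).trans (by linarith)

theorem sq_le_two_mul_exp {r : ℝ} (hr : 0 ≤ r) : r ^ 2 ≤ 2 * Real.exp r := by
  have := Real.quadratic_le_exp_of_nonneg hr
  nlinarith

/-- The Taylor remainder carries a factor a², which must disappear for a bound uniform in the modes.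
For |h| ≤ t/2 at least half of the decay exp(−at) survives, and it absorbs (at)². -/
theorem abs_exp_remainder_le {a t h : ℝ} (ha : 0 ≤ a) (ht : 0 < t) (hh : |h| ≤ t / 2) :
    |Real.exp (-a * (t + h)) - Real.exp (-a * t) - h * (-a * Real.exp (-a * t))|
      ≤ 8 / t ^ 2 * h ^ 2 := by
  have h1 : |Real.exp (-a * h) - 1 - (-a * h)| ≤ (a * h) ^ 2 * Real.exp (a * |h|) := by
    have := Complex.norm_exp_sub_sum_le_norm_mul_exp ((-a * h : ℝ) : ℂ) 2
    rw [Finset.sum_range_succ, Finset.sum_range_one] at this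
    simp only [pow_zero, Nat.factorial_zero, Nat.cast_one, div_one, pow_one, Nat.factorial_one]
      at this
    rw [← Complex.ofReal_exp, ← Complex.ofReal_one, ← Complex.ofReal_add, ← Complex.ofReal_sub,
      Complex.norm_real, Complex.norm_real, Real.norm_eq_abs, Real.norm_eq_abs, sq_abs, abs_mul,
      abs_neg, abs_of_nonneg ha] at this
    calc _ = |Real.exp (-a * h) - (1 + -a * h)| := by ring_nf
      _ ≤ _ := this
      _ = _ := by ring
  have h2 : Real.exp (-a * (t + h)) - Real.exp (-a * t) - h * (-a * Real.exp (-a * t))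
      = Real.exp (-a * t) * (Real.exp (-a * h) - 1 - (-a * h)) := by
    rw [mul_add, Real.exp_add]; ring
  have h3 : Real.exp (a * |h|) ≤ Real.exp (a * t / 2) := by
    apply Real.exp_le_exp.2
    have := mul_le_mul_of_nonneg_left hh ha
    linarith
  have h4 : (a * t / 2) ^ 2 ≤ 2 * Real.exp (a * t / 2) := sq_le_two_mul_exp (by positivity)
  have h5 : Real.exp (-a * t) * Real.exp (a * t / 2) * Real.exp (a * t / 2) = 1 := by
    rw [← Real.exp_add, ← Real.exp_add, Real.exp_eq_one_iff]; ring
  rw [h2, abs_mul, Real.abs_exp]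
  calc _ ≤ Real.exp (-a * t) * ((a * h) ^ 2 * Real.exp (a * t / 2)) := by
        gcongr
        exact h1.trans (by gcongr)
    _ = (4 / t ^ 2 * h ^ 2) * (Real.exp (-a * t) * Real.exp (a * t / 2) * (a * t / 2) ^ 2) := by
        field_simp
        ring
    _ ≤ (4 / t ^ 2 * h ^ 2) * (Real.exp (-a * t) * Real.exp (a * t / 2) *
          (2 * Real.exp (a * t / 2))) := by gcongr
    _ = (4 / t ^ 2 * h ^ 2) *
          (2 * (Real.exp (-a * t) * Real.exp (a * t / 2) * Real.exp (a * t / 2))) := by ring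
    _ = _ := by rw [h5]; ring

-- Parabolic smoothing: for t > 0 the derivative exists in norm for every initial vector, since the
-- remainder of each coordinate is bounded uniformly in its rate.
include hν in
theorem exists_hasDerivAt_of_repr_eq_exp {p : ℝ → E} {x : E}
    (hp : ∀ s, 0 < s → ∀ i, coord b i (p s) = Real.exp (-ν i * s) * coord b i x) {t : ℝ}
    (ht : 0 < t) : ∃ q, HasDerivAt p q t ∧ ∀ i, coord b i q = -ν i * coord b i (p t) := by
  -- The multipliers of the derivative are bounded by 1/t because r exp(−r) ≤ 1.
  have hbd : ∀ i, |-ν i * Real.exp (-ν i * t)| ≤ t⁻¹ := fun i => by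
    rw [abs_mul, abs_neg, abs_of_nonneg (hν i), Real.abs_exp, ← mul_le_mul_iff_left₀ ht,
      inv_mul_cancel₀ ht.ne']
    have h1 := Real.add_one_le_exp (ν i * t)
    calc ν i * Real.exp (-ν i * t) * t = ν i * t * Real.exp (-ν i * t) := by ring
      _ ≤ Real.exp (ν i * t) * Real.exp (-ν i * t) := by gcongr; linarith
      _ = 1 := by rw [← Real.exp_add]; simp
  refine ⟨diagOp b _ _ hbd x, ?_, fun i => by rw [repr_diagOp, hp t ht]; ring⟩
  rw [hasDerivAt_iff_isLittleO_nhds_zero]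
  refine Asymptotics.IsBigO.trans_isLittleO (g := fun h : ℝ => h ^ 2) ?_ ?_
  · refine Asymptotics.IsBigO.of_bound (8 / t ^ 2 * ‖x‖) ?_
    have : ∀ᶠ h : ℝ in 𝓝 0, |h| < t / 2 := by
      have := (continuous_abs (G := ℝ)).tendsto 0
      rw [abs_zero] at this
      exact this.eventually (gt_mem_nhds (by linarith))
    filter_upwards [this] with h hh
    have hth : 0 < t + h := by have := neg_abs_le h; linarith
    have : ‖p (t + h) - p t - h • diagOp b _ _ hbd x‖ ≤ (8 / t ^ 2 * h ^ 2) * ‖x‖ := by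
      refine norm_le_of_abs_repr_le b (by positivity) fun i => ?_
      have e : coord b i (p (t + h) - p t - h • diagOp b _ _ hbd x)
          = (Real.exp (-ν i * (t + h)) - Real.exp (-ν i * t) - h * (-ν i * Real.exp (-ν i * t)))
            * coord b i x := by
        simp only [map_sub, map_smul,
          repr_diagOp, hp t ht, hp _ hth, smul_eq_mul]
        ring
      rw [e, abs_mul]
      exact mul_le_mul_of_nonneg_right (abs_exp_remainder_le (hν i) ht hh.le) (abs_nonneg _)
    refine this.trans_eq ?_
    rw [norm_pow, Real.norm_eq_abs, sq_abs]
    ring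
  · simpa using Asymptotics.isLittleO_pow_id (𝕜 := ℝ) (n := 2) (by norm_num)

/-- The product exp(at) f(t) has derivative zero. The mean value theorem needs only continuity at
the end point 0, which is all that a solution provides there. -/
theorem eq_exp_mul_of_hasDerivAt {f : ℝ → ℝ} {a : ℝ} (hc : ContinuousOn f (Ici 0))
    (hd : ∀ t, 0 < t → HasDerivAt f (-a * f t) t) {t : ℝ} (ht : 0 ≤ t) :
    f t = Real.exp (-a * t) * f 0 := by
  have hderiv : ∀ s, 0 < s → HasDerivAt (fun s => Real.exp (a * s) * f s) 0 s := by
    intro s hs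
    have h1 := hasDerivAt_exp_neg_mul (-a) s
    simp only [neg_neg] at h1
    refine (h1.mul (hd s hs)).congr_deriv ?_
    ring
  have hcont : ContinuousOn (fun s => Real.exp (a * s) * f s) (Ici 0) :=
    (by fun_prop : Continuous fun s => Real.exp (a * s)).continuousOn.mul hc
  have key : Real.exp (a * t) * f t = Real.exp (a * 0) * f 0 := by
    rcases ht.eq_or_lt with rfl | ht
    · rfl
    · obtain ⟨c, hc, h⟩ := exists_hasDerivAt_eq_slope _ (fun _ => 0) ht
        (hcont.mono Icc_subset_Ici_self) fun s hs => hderiv s hs.1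
      rw [eq_comm, div_eq_zero_iff, sub_eq_zero] at h
      exact h.resolve_right (by linarith)
  rw [mul_zero, Real.exp_zero, one_mul] at key
  rw [← key, ← mul_assoc, ← Real.exp_add]
  simp

end HilbertBasis

/-! ### The abstract modal system and its output -/

/-- A self-adjoint evolution in modal form: `J` maps the state space `X` to the pivot space `H`,
both are diagonalised by the same modes, with decay rates `rate i`, of which only the one of the
mode `zero` vanishes. `sensor i` is the output of the mode `i`. -/
structure ModalSystem (ι X H : Type*) [NormedAddCommGroup X] [InnerProductSpace ℝ X]
    [NormedAddCommGroup H] [InnerProductSpace ℝ H] where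
  /-- The embedding of the state space into the pivot space. -/
  J : X →L[ℝ] H
  /-- The modes, normalised in the pivot space. -/
  e : HilbertBasis ι ℝ H
  /-- The modes, normalised in the state space. -/
  f : HilbertBasis ι ℝ X
  /-- The ratio of the two normalisations. -/
  weight : ι → ℝ
  weight_pos : ∀ i, 0 < weight i
  coord_f : ∀ i x, coord f i x = weight i * coord e i (J x)
  /-- The decay rates. -/
  rate : ι → ℝ
  /-- The unstable mode. -/
  zero : ι
  rate_zero : rate zero = 0
  /-- Half of a lower bound for the decay rates of the stable modes. -/
  gap : ℝ
  gap_pos : 0 < gap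
  gap_le : ∀ i, i ≠ zero → 2 * gap ≤ rate i
  -- This growth of the rates makes the output series converge on the domain and the shear
  -- coefficients square summable.
  summable_rate : Summable fun i => ((1 + rate i) ^ 2)⁻¹
  /-- The unstable mode as an element of the state space. -/
  unstable : X
  J_unstable : J unstable = e zero
  /-- The outputs of the modes. -/
  sensor : ι → ℝ
  /-- A bound for the outputs of the modes. -/
  bound : ℝ
  sensor_le : ∀ i, |sensor i| ≤ bound
  sensor_zero : sensor zero ≠ 0

namespace ModalSystem

variable {ι X H : Type*} [NormedAddCommGroup X] [InnerProductSpace ℝ X]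
    [NormedAddCommGroup H] [InnerProductSpace ℝ H] (M : ModalSystem ι X H)

theorem rate_nonneg (i : ι) : 0 ≤ M.rate i := by
  by_cases h : i = M.zero
  · rw [h, M.rate_zero]
  · linarith [M.gap_pos, M.gap_le i h]

theorem bound_nonneg : 0 ≤ M.bound := (abs_nonneg _).trans (M.sensor_le M.zero)

theorem coord_zero_self : coord M.e M.zero (M.e M.zero) = 1 := by
  rw [coord_apply, real_inner_self_eq_norm_sq, M.e.orthonormal.1]; norm_num

theorem coord_zero_of_ne {i : ι} (h : i ≠ M.zero) : coord M.e i (M.e M.zero) = 0 :=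
  M.e.orthonormal.2 h

/-- `v` is the image of `x` under the diagonal operator with eigenvalues `- rate i`. -/
def Generates (x v : H) : Prop := ∀ i, coord M.e i v = -M.rate i * coord M.e i x

/-- The output functional. -/
def output (x : H) : ℝ := ∑' i, M.sensor i * coord M.e i x

/-- The numbers (1 + rate) xᵢ are the coordinates of `x - v`, hence square summable, and so are the
(1 + rate)⁻¹; their product is controlled by the sum of the squares. -/
theorem Generates.summable_coord {M : ModalSystem ι X H} {x v : H} (h : M.Generates x v) :
    Summable fun i => |coord M.e i x| := by
  refine Summable.of_nonneg_of_le (fun i => abs_nonneg _) (fun i => ?_)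
    (M.summable_rate.add (hasSum_repr_sq M.e (x - v)).summable)
  have h0 : 0 < 1 + M.rate i := by linarith [M.rate_nonneg i]
  have h1 : coord M.e i (x - v) = (1 + M.rate i) * coord M.e i x := by
    rw [map_sub, h i]; ring
  rw [h1, ← inv_pow, ← sq_abs ((1 + M.rate i) * _), abs_mul, abs_of_pos h0]
  set r := 1 + M.rate i
  have h2 : r⁻¹ * (r * |coord M.e i x|) = |coord M.e i x| := by field_simp
  nlinarith [sq_nonneg (r⁻¹ - r * |coord M.e i x|), sq_nonneg (r⁻¹ + r * |coord M.e i x|),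
    abs_nonneg (coord M.e i x)]

theorem Generates.hasSum_output {M : ModalSystem ι X H} {x v : H} (h : M.Generates x v) :
    HasSum (fun i => M.sensor i * coord M.e i x) (M.output x) := by
  refine (Summable.of_norm_bounded (h.summable_coord.mul_left M.bound) fun i => ?_).hasSum
  rw [Real.norm_eq_abs, abs_mul]
  exact mul_le_mul_of_nonneg_right (M.sensor_le i) (abs_nonneg _)

theorem Generates.sub {M : ModalSystem ι X H} {x v x' v' : H} (h : M.Generates x v)
    (h' : M.Generates x' v') : M.Generates (x - x') (v - v') := fun i => by
  rw [map_sub, map_sub, h i, h' i]; ring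

/-- Convergence of both series comes from membership in the domain; without it `tsum` need not be
additive. -/
theorem output_sub {x v x' v' : H} (h : M.Generates x v)
    (h' : M.Generates x' v') : M.output (x - x') = M.output x - M.output x' := by
  refine ((h.sub h').hasSum_output).unique ?_
  refine (h.hasSum_output.sub h'.hasSum_output).congr_fun fun i => ?_
  rw [map_sub, mul_sub]

/-! ### The shear that diagonalises the estimator -/

/-- The output injection gain that shifts the unstable eigenvalue to `- gap`. -/
def gain : ℝ := M.gap / M.sensor M.zero

open Classical in
/-- The components along the unstable mode of the eigenvectors of the estimator. -/
def shear (i : ι) : ℝ := if i = M.zero then 0 else M.gain * M.sensor i / (M.rate i - M.gap)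

open Classical in
/-- The decay rates of the estimator. -/
def shiftedRate (i : ι) : ℝ := if i = M.zero then M.gap else M.rate i

theorem gap_le_shiftedRate (i : ι) : M.gap ≤ M.shiftedRate i := by
  unfold shiftedRate
  split_ifs with h
  · rfl
  · linarith [M.gap_le i h, M.gap_pos]

theorem shiftedRate_nonneg (i : ι) : 0 ≤ M.shiftedRate i :=
  M.gap_pos.le.trans (M.gap_le_shiftedRate i)

/-- From rate ≥ 2 gap one gets (rate − gap)(1 + 2 gap) ≥ gap (1 + rate), so the denominators grow
like the rates. -/
theorem abs_shear_le (i : ι) :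
    |M.shear i| ≤ |M.gain| * M.bound * ((1 + 2 * M.gap) / M.gap) * (1 + M.rate i)⁻¹ := by
  have hg := M.gap_pos
  have hr := M.rate_nonneg i
  have hB := M.bound_nonneg
  unfold shear
  split_ifs with h
  · rw [abs_zero]; positivity
  · have h1 := M.gap_le i h
    have h2 : 0 < M.rate i - M.gap := by linarith
    rw [abs_div, abs_mul, abs_of_pos h2, div_eq_mul_inv, mul_assoc (|M.gain| * M.bound)]
    refine mul_le_mul (mul_le_mul_of_nonneg_left (M.sensor_le i) (abs_nonneg _)) ?_
      (inv_nonneg.2 h2.le) (by positivity)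
    rw [← div_eq_mul_inv, div_div, inv_le_comm₀ h2 (by positivity), inv_div, div_le_iff₀ (by positivity)]
    nlinarith

theorem summable_shear : Summable fun i => M.shear i ^ 2 := by
  refine Summable.of_nonneg_of_le (fun i => sq_nonneg _) (fun i => ?_)
    (M.summable_rate.mul_left ((|M.gain| * M.bound * ((1 + 2 * M.gap) / M.gap)) ^ 2))
  rw [← sq_abs, ← inv_pow, ← mul_pow]
  exact pow_le_pow_left₀ (abs_nonneg _) (M.abs_shear_le i) 2

/-- The functional with coefficients `shear i`. -/
def shearFunctional : H →L[ℝ] ℝ := innerSL ℝ (exists_repr_eq M.e M.summable_shear).choose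

theorem hasSum_shearFunctional (x : H) :
    HasSum (fun i => M.shear i * coord M.e i x) (M.shearFunctional x) := by
  have h := (exists_repr_eq M.e M.summable_shear).choose_spec
  refine (M.e.hasSum_inner_mul_inner (exists_repr_eq M.e M.summable_shear).choose x).congr_fun
    fun i => ?_
  rw [real_inner_comm, ← coord_apply, ← coord_apply, h]

/-- The value 0 of `shear` at the unstable mode makes the rank-one part of the shear square to zero,
so the inverse is obtained by changing a sign. -/
theorem shearFunctional_zero : M.shearFunctional (M.e M.zero) = 0 := by
  refine (M.hasSum_shearFunctional _).unique ?_
  refine hasSum_zero.congr_fun fun i => ?_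
  by_cases h : i = M.zero
  · rw [shear, if_pos h, zero_mul]
  · rw [M.coord_zero_of_ne h, mul_zero]

/-- This is the equation that determines the shear. For a stable mode, shear · (gap − rate) = −gain
· sensor, so the left side is −gain times the output series without its unstable term. That term is
gain · sensor = gap times the coordinate, by the choice of gain. -/
theorem Generates.shearFunctional_eq {M : ModalSystem ι X H} {x v : H} (h : M.Generates x v) :
    M.shearFunctional v + M.gap * M.shearFunctional x
      = -M.gain * M.output x + M.gap * coord M.e M.zero x := by
  classical
  have h1 := (M.hasSum_shearFunctional v).add ((M.hasSum_shearFunctional x).mul_left M.gap)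
  have h2 := (h.hasSum_output.mul_left (-M.gain)).add
    (hasSum_ite_eq M.zero (M.gap * coord M.e M.zero x))
  refine h1.unique (h2.congr_fun fun i => ?_)
  rw [h i]
  by_cases hi : i = M.zero
  · subst hi
    have := M.sensor_zero
    simp only [shear, if_true, gain]
    field_simp
    ring
  · have h3 : M.rate i - M.gap ≠ 0 := by linarith [M.gap_le i hi, M.gap_pos]
    simp only [shear, if_neg hi]
    field_simp
    ring

/-- The estimator operator, as a relation between a state and its image in the pivot space. -/
def EstimatorGenerates (x y : H) : Prop :=
  ∃ v, M.Generates x v ∧ y = v - (M.gain * M.output x) • M.e M.zero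

/-- The transformation that diagonalises the estimator, in the pivot space. -/
def straighten (x : H) : H := x - M.shearFunctional x • M.e M.zero

theorem coord_straighten_of_ne {i : ι} (hi : i ≠ M.zero) (x : H) :
    coord M.e i (M.straighten x) = coord M.e i x := by
  rw [straighten, map_sub, map_smul, M.coord_zero_of_ne hi, smul_zero, sub_zero]

theorem coord_straighten_zero (x : H) :
    coord M.e M.zero (M.straighten x) = coord M.e M.zero x - M.shearFunctional x := by
  rw [straighten, map_sub, map_smul, M.coord_zero_self, smul_eq_mul, mul_one]

/-- Neither the injection nor the shear touches the stable coordinates. In the unstable coordinate,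
`Generates.shearFunctional_eq` combines the output and the shear into −gap times the straightened
coordinate. -/
theorem estimatorGenerates_iff (x y : H) : M.EstimatorGenerates x y ↔
    ∀ i, coord M.e i (M.straighten y) = -M.shiftedRate i * coord M.e i (M.straighten x) := by
  constructor
  · rintro ⟨v, h, rfl⟩ i
    by_cases hi : i = M.zero
    · subst hi
      have h1 := h.shearFunctional_eq
      have h2 := h M.zero
      rw [M.rate_zero, neg_zero, zero_mul] at h2
      rw [coord_straighten_zero, coord_straighten_zero, map_sub, map_sub, map_smul, map_smul,
        M.coord_zero_self, M.shearFunctional_zero, shiftedRate, if_pos rfl, h2]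
      simp only [smul_eq_mul]
      linarith
    · rw [coord_straighten_of_ne M hi, coord_straighten_of_ne M hi, map_sub, map_smul,
        M.coord_zero_of_ne hi, shiftedRate, if_neg hi, smul_zero, sub_zero, h i]
  · intro h
    -- The free generator maps into vectors without unstable component, so its value can only be `y`
    -- with that component removed; the unstable equation then says that the removed part is the
    -- injection term.
    have hv : M.Generates x (y - coord M.e M.zero y • M.e M.zero) := fun i => by
      by_cases hi : i = M.zero
      · subst hi
        rw [map_sub, map_smul, M.coord_zero_self, M.rate_zero]
        simp
      · have := h i
        rw [coord_straighten_of_ne M hi, coord_straighten_of_ne M hi, shiftedRate, if_neg hi] at this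
        rw [map_sub, map_smul, M.coord_zero_of_ne hi, this, smul_zero, sub_zero]
    refine ⟨_, hv, ?_⟩
    have h1 := hv.shearFunctional_eq
    have h2 := h M.zero
    rw [coord_straighten_zero, coord_straighten_zero, shiftedRate, if_pos rfl] at h2
    rw [map_sub, map_smul, M.shearFunctional_zero, smul_zero, sub_zero] at h1
    have h3 : coord M.e M.zero y = -(M.gain * M.output x) := by linarith
    rw [h3, neg_smul]
    abel

/-! ### Semigroup, generator and stability of the estimator -/

/-- The transformation that diagonalises the estimator, in the state space. -/
def toDiag : X →L[ℝ] X :=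
  ContinuousLinearMap.id ℝ X - (M.shearFunctional.comp M.J).smulRight M.unstable

/-- The inverse of `toDiag`. -/
def ofDiag : X →L[ℝ] X :=
  ContinuousLinearMap.id ℝ X + (M.shearFunctional.comp M.J).smulRight M.unstable

theorem toDiag_apply (x : X) : M.toDiag x = x - M.shearFunctional (M.J x) • M.unstable := rfl

theorem ofDiag_apply (x : X) : M.ofDiag x = x + M.shearFunctional (M.J x) • M.unstable := rfl

theorem J_toDiag (x : X) : M.J (M.toDiag x) = M.straighten (M.J x) := by
  rw [toDiag_apply, map_sub, map_smul, J_unstable, straighten]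

theorem toDiag_ofDiag (x : X) : M.toDiag (M.ofDiag x) = x := by
  rw [toDiag_apply, ofDiag_apply, map_add, map_smul, J_unstable, map_add, map_smul,
    M.shearFunctional_zero, smul_zero, add_zero]
  abel

theorem ofDiag_toDiag (x : X) : M.ofDiag (M.toDiag x) = x := by
  rw [ofDiag_apply, toDiag_apply, map_sub, map_smul, J_unstable, map_sub, map_smul,
    M.shearFunctional_zero, smul_zero, sub_zero]
  abel

/-- The semigroup of the estimator. -/
def estimatorFlow (t : ℝ) : X →L[ℝ] X :=
  M.ofDiag.comp ((expDiag M.f M.shiftedRate M.shiftedRate_nonneg t).comp M.toDiag)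

theorem estimatorFlow_apply (t : ℝ) (x : X) : M.estimatorFlow t x =
    M.ofDiag (expDiag M.f M.shiftedRate M.shiftedRate_nonneg t (M.toDiag x)) := rfl

theorem isC0Semigroup_estimatorFlow : IsC0Semigroup M.estimatorFlow where
  zero := by
    ext x
    rw [estimatorFlow_apply, (isC0Semigroup_expDiag M.f M.shiftedRate_nonneg).zero]
    exact M.ofDiag_toDiag x
  add s t hs ht := by
    ext x
    rw [ContinuousLinearMap.comp_apply, estimatorFlow_apply, estimatorFlow_apply,
      estimatorFlow_apply, toDiag_ofDiag,
      (isC0Semigroup_expDiag M.f M.shiftedRate_nonneg).add s t hs ht,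
      ContinuousLinearMap.comp_apply]
  strong x := by
    have h := (isC0Semigroup_expDiag M.f M.shiftedRate_nonneg).strong (M.toDiag x)
    have h2 := (M.ofDiag.continuous.tendsto _).comp h
    rw [M.ofDiag_toDiag] at h2
    exact h2

theorem continuous_estimatorFlow (x : X) : Continuous fun t => M.estimatorFlow t x :=
  M.ofDiag.continuous.comp (continuous_expDiag M.f M.shiftedRate_nonneg _)

theorem isExpStable_estimatorFlow : IsExpStable M.estimatorFlow := by
  -- The summands 1 keep the constant strictly positive without any lower bound on the operator
  -- norms.
  refine ⟨(‖M.ofDiag‖ + 1) * (‖M.toDiag‖ + 1), M.gap, by positivity, M.gap_pos, fun t ht => ?_⟩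
  calc ‖M.estimatorFlow t‖
      ≤ ‖M.ofDiag‖ * (‖expDiag M.f M.shiftedRate M.shiftedRate_nonneg t‖ * ‖M.toDiag‖) :=
        (ContinuousLinearMap.opNorm_comp_le _ _).trans
          (mul_le_mul_of_nonneg_left (ContinuousLinearMap.opNorm_comp_le _ _) (norm_nonneg _))
    _ ≤ (‖M.ofDiag‖ + 1) * (Real.exp (-M.gap * t) * (‖M.toDiag‖ + 1)) := by
        gcongr
        · linarith
        · exact norm_expDiag_le M.f M.shiftedRate_nonneg M.gap_le_shiftedRate ht
        · linarith
    _ = _ := by ring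

/-- A bounded isomorphism transports difference quotients both ways, so the question is about the
diagonal flow. Since the state and pivot coordinates differ by positive weights, which cancel, its
criterion is the one of `estimatorGenerates_iff`. -/
theorem isGeneratedBy_estimatorFlow :
    IsGeneratedBy (fun x y => M.EstimatorGenerates (M.J x) (M.J y)) M.estimatorFlow := by
  intro x y
  have h1 : Tendsto (fun t : ℝ => t⁻¹ • (M.estimatorFlow t x - x)) (𝓝[>] 0) (𝓝 y) ↔
      Tendsto (fun t : ℝ => t⁻¹ • (expDiag M.f M.shiftedRate M.shiftedRate_nonneg t (M.toDiag x)
        - M.toDiag x)) (𝓝[>] 0) (𝓝 (M.toDiag y)) := by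
    constructor
    · intro h
      refine ((M.toDiag.continuous.tendsto _).comp h).congr fun t => ?_
      rw [Function.comp_apply, map_smul, map_sub, estimatorFlow_apply, toDiag_ofDiag]
    · intro h
      have := (M.ofDiag.continuous.tendsto _).comp h
      rw [ofDiag_toDiag] at this
      refine this.congr fun t => ?_
      rw [Function.comp_apply, map_smul, map_sub, ofDiag_toDiag, estimatorFlow_apply]
  rw [h1, tendsto_slope_expDiag_iff]
  refine (M.estimatorGenerates_iff _ _).trans (forall_congr' fun i => ?_)
  rw [M.coord_f, M.coord_f, J_toDiag, J_toDiag, mul_left_comm,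
    mul_right_inj' (M.weight_pos i).ne']

/-! ### Existence and uniqueness for the error equation and the free equation -/

/-- Solutions of the estimation error equation. -/
structure IsErrorSolution (x₀ : X) (x : ℝ → X) : Prop where
  cont : ContinuousOn x (Ici 0)
  init : x 0 = x₀
  eqn : ∀ t : ℝ, 0 < t → ∃ y : H, M.EstimatorGenerates (M.J (x t)) y ∧
    HasDerivAt (fun s => M.J (x s)) y t

/-- Straightening in the pivot space as a bounded operator. -/
def straightenL : H →L[ℝ] H :=
  ContinuousLinearMap.id ℝ H - M.shearFunctional.smulRight (M.e M.zero)

theorem isErrorSolution_estimatorFlow (x₀ : X) :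
    M.IsErrorSolution x₀ (fun t => M.estimatorFlow t x₀) where
  cont := (M.continuous_estimatorFlow x₀).continuousOn
  init := by rw [M.isC0Semigroup_estimatorFlow.zero]; rfl
  eqn t ht := by
    have hp : ∀ s, 0 < s → ∀ i, coord M.e i
        (M.J (expDiag M.f M.shiftedRate M.shiftedRate_nonneg s (M.toDiag x₀)))
          = Real.exp (-M.shiftedRate i * s) * coord M.e i (M.J (M.toDiag x₀)) := by
      intro s hs i
      have := repr_expDiag M.f M.shiftedRate_nonneg hs.le (M.toDiag x₀) i
      rw [M.coord_f, M.coord_f, mul_left_comm] at this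
      exact mul_left_cancel₀ (M.weight_pos i).ne' this
    obtain ⟨q, hq, hqi⟩ := exists_hasDerivAt_of_repr_eq_exp M.e M.shiftedRate_nonneg hp ht
    -- The derivative of the diagonal flow is carried back by the inverse shear in the pivot space.
    refine ⟨q + M.shearFunctional q • M.e M.zero, ?_, ?_⟩
    · rw [M.estimatorGenerates_iff]
      intro i
      have e1 : M.straighten (q + M.shearFunctional q • M.e M.zero) = q := by
        rw [straighten, map_add, map_smul, M.shearFunctional_zero, smul_zero, add_zero]
        abel
      rw [e1, ← J_toDiag, estimatorFlow_apply, toDiag_ofDiag, hqi i]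
    · have e2 : (fun s => M.J (M.estimatorFlow s x₀)) = fun s =>
          M.J (expDiag M.f M.shiftedRate M.shiftedRate_nonneg s (M.toDiag x₀)) +
          M.shearFunctional (M.J (expDiag M.f M.shiftedRate M.shiftedRate_nonneg s
            (M.toDiag x₀))) • M.e M.zero := by
        funext s
        rw [estimatorFlow_apply, ofDiag_apply, map_add, map_smul, J_unstable]
      rw [e2]
      exact hq.add ((M.shearFunctional.hasFDerivAt.comp_hasDerivAt t hq).smul_const _)

/-- Straightening decouples the equation: every coordinate of the transformed solution obeys a
scalar linear equation and is determined by its initial value. -/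
theorem IsErrorSolution.eq_estimatorFlow {M : ModalSystem ι X H} {x₀ : X} {x : ℝ → X}
    (h : M.IsErrorSolution x₀ x) {t : ℝ} (ht : 0 ≤ t) : x t = M.estimatorFlow t x₀ := by
  have key : M.toDiag (x t) = expDiag M.f M.shiftedRate M.shiftedRate_nonneg t (M.toDiag x₀) := by
    refine repr_ext M.f fun i => ?_
    rw [repr_expDiag _ _ ht, ← h.init, M.coord_f, M.coord_f, mul_left_comm]
    congr 1
    refine eq_exp_mul_of_hasDerivAt (f := fun s => coord M.e i (M.J (M.toDiag (x s)))) ?_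
      (fun s hs => ?_) ht
    · exact ((coord M.e i).comp (M.J.comp M.toDiag)).continuous.comp_continuousOn h.cont
    · obtain ⟨y, hy, hd⟩ := h.eqn s hs
      rw [J_toDiag, ← (M.estimatorGenerates_iff _ _).1 hy i]
      have := (((coord M.e i).comp M.straightenL).hasFDerivAt.comp_hasDerivAt s hd)
      refine this.congr_of_eventuallyEq (Eventually.of_forall fun r => ?_)
      exact congrArg _ (M.J_toDiag (x r))
  rw [estimatorFlow_apply, ← key, ofDiag_toDiag]

/-- Solutions of the free system. -/
structure IsFreeSolution (x₀ : X) (x : ℝ → X) : Prop where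
  cont : ContinuousOn x (Ici 0)
  init : x 0 = x₀
  eqn : ∀ t : ℝ, 0 < t → ∃ v : H, M.Generates (M.J (x t)) v ∧ HasDerivAt (fun s => M.J (x s)) v t

theorem isFreeSolution_expDiag (x₀ : X) :
    M.IsFreeSolution x₀ (fun t => expDiag M.f M.rate M.rate_nonneg t x₀) where
  cont := (continuous_expDiag M.f M.rate_nonneg x₀).continuousOn
  init := by rw [(isC0Semigroup_expDiag M.f M.rate_nonneg).zero]; rfl
  eqn t ht := by
    obtain ⟨q, hq, hqi⟩ := exists_hasDerivAt_of_repr_eq_exp M.e M.rate_nonneg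
      (p := fun s => M.J (expDiag M.f M.rate M.rate_nonneg s x₀)) (x := M.J x₀)
      (fun s hs i => by
        have := repr_expDiag M.f M.rate_nonneg hs.le x₀ i
        rw [M.coord_f, M.coord_f, mul_left_comm] at this
        exact mul_left_cancel₀ (M.weight_pos i).ne' this) ht
    exact ⟨q, hqi, hq⟩

theorem IsFreeSolution.eq_expDiag {M : ModalSystem ι X H} {x₀ : X} {x : ℝ → X}
    (h : M.IsFreeSolution x₀ x) {t : ℝ} (ht : 0 ≤ t) :
    x t = expDiag M.f M.rate M.rate_nonneg t x₀ := by
  refine repr_ext M.f fun i => ?_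
  rw [repr_expDiag _ _ ht, ← h.init, M.coord_f, M.coord_f, mul_left_comm]
  congr 1
  refine eq_exp_mul_of_hasDerivAt (f := fun s => coord M.e i (M.J (x s))) ?_ (fun s hs => ?_) ht
  · exact ((coord M.e i).comp M.J).continuous.comp_continuousOn h.cont
  · obtain ⟨v, hv, hd⟩ := h.eqn s hs
    rw [← hv i]
    exact (coord M.e i).hasFDerivAt.comp_hasDerivAt s hd

end ModalSystem

/-! ### Neumann modes of an interval -/

section Cosines

variable {a c : ℝ}

/-- The angular frequency of the `i`-th Neumann mode of an interval. -/
def freq (a c : ℝ) (i : ℕ) : ℝ := i * Real.pi / (c - a)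

/-- The `i`-th Neumann mode of an interval, not normalised. -/
def cosMode (a c : ℝ) (i : ℕ) (x : ℝ) : ℝ := Real.cos (freq a c i * (x - a))

theorem continuous_cosMode (a c : ℝ) (i : ℕ) : Continuous (cosMode a c i) := by
  unfold cosMode; fun_prop

theorem cosMode_zero (a c x : ℝ) : cosMode a c 0 x = 1 := by simp [cosMode, freq]

/-- Sums and absolute differences of indices are again indices, so the span of the cosines is an
algebra; the same formula gives orthogonality. -/
theorem cosMode_mul (a c : ℝ) (i j : ℕ) (x : ℝ) : cosMode a c i x * cosMode a c j x =
    (1 / 2) * (cosMode a c (i + j) x + cosMode a c ((i : ℤ) - j).natAbs x) := by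
  have h : cosMode a c ((i : ℤ) - j).natAbs x
      = Real.cos (freq a c i * (x - a) - freq a c j * (x - a)) := by
    rcases le_total i j with hij | hij
    · have : (((i : ℤ) - j).natAbs : ℝ) = (j : ℝ) - i := by
        rw [show ((i : ℤ) - j).natAbs = j - i by omega, Nat.cast_sub hij]
      rw [cosMode, freq, this, ← Real.cos_neg, freq, freq]
      congr 1; ring
    · have : (((i : ℤ) - j).natAbs : ℝ) = (i : ℝ) - j := by
        rw [show ((i : ℤ) - j).natAbs = i - j by omega, Nat.cast_sub hij]
      rw [cosMode, freq, this, freq, freq]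
      congr 1; ring
  have h' : cosMode a c (i + j) x = Real.cos (freq a c i * (x - a) + freq a c j * (x - a)) := by
    rw [cosMode, freq, freq, freq, Nat.cast_add]
    congr 1; ring
  rw [h, h', Real.cos_add, Real.cos_sub, cosMode, cosMode]
  ring

theorem setIntegral_cosMode (hac : a < c) {i : ℕ} (hi : i ≠ 0) :
    ∫ x in Ioo a c, cosMode a c i x = 0 := by
  have hf : freq a c i ≠ 0 := by
    have : (i : ℝ) ≠ 0 := Nat.cast_ne_zero.2 hi
    have : c - a ≠ 0 := by linarith
    have := Real.pi_ne_zero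
    unfold freq; positivity
  rw [← integral_Ioc_eq_integral_Ioo, ← intervalIntegral.integral_of_le hac.le]
  have hd : ∀ x, HasDerivAt (fun x => Real.sin (freq a c i * (x - a)) / freq a c i)
      (cosMode a c i x) x := by
    intro x
    have h1 := ((((hasDerivAt_id x).sub_const a).const_mul (freq a c i)).sin).div_const (freq a c i)
    refine h1.congr_deriv ?_
    simp only [id, cosMode]
    field_simp
  rw [intervalIntegral.integral_eq_sub_of_hasDerivAt (fun x _ => hd x)
    ((continuous_cosMode a c i).intervalIntegrable _ _)]
  have : freq a c i * (c - a) = i * Real.pi := by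
    have : c - a ≠ 0 := by linarith
    unfold freq; field_simp
  rw [this, Real.sin_nat_mul_pi]
  simp

theorem setIntegral_cosMode_zero (hac : a < c) : ∫ x in Ioo a c, cosMode a c 0 x = c - a := by
  simp [cosMode_zero, hac.le]

/-- The square of the `L²` norm of `cosMode a c i`. -/
def cosNormSq (a c : ℝ) (i : ℕ) : ℝ := if i = 0 then c - a else (c - a) / 2

theorem cosNormSq_pos (hac : a < c) (i : ℕ) : 0 < cosNormSq a c i := by
  unfold cosNormSq; split_ifs <;> linarith

theorem half_le_cosNormSq (hac : a < c) (i : ℕ) : (c - a) / 2 ≤ cosNormSq a c i := by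
  unfold cosNormSq; split_ifs <;> linarith

theorem integrableOn_cosMode (a c : ℝ) (i : ℕ) : IntegrableOn (cosMode a c i) (Ioo a c) :=
  ((continuous_cosMode a c i).continuousOn.integrableOn_Icc).mono_set Ioo_subset_Icc_self

theorem setIntegral_cosMode_mul (hac : a < c) (i j : ℕ) :
    ∫ x in Ioo a c, cosMode a c i x * cosMode a c j x = if i = j then cosNormSq a c i else 0 := by
  simp only [cosMode_mul]
  rw [integral_const_mul, integral_add (integrableOn_cosMode a c _) (integrableOn_cosMode a c _)]
  by_cases hij : i = j
  · subst hij
    rw [if_pos rfl, show ((i : ℤ) - i).natAbs = 0 by simp, setIntegral_cosMode_zero hac, cosNormSq]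
    by_cases hi : i = 0
    · subst hi
      rw [setIntegral_cosMode_zero hac, if_pos rfl]
      ring
    · rw [setIntegral_cosMode hac (by omega), if_neg hi]
      ring
  · rw [if_neg hij, setIntegral_cosMode hac (by omega), setIntegral_cosMode hac (by omega)]
    ring

/-- The `i`-th Neumann mode of an interval, normalised in `L²`. -/
def unitCos (a c : ℝ) (i : ℕ) (x : ℝ) : ℝ := (√(cosNormSq a c i))⁻¹ * cosMode a c i x

theorem contDiff_unitCos (a c : ℝ) (i : ℕ) {n : WithTop ℕ∞} : ContDiff ℝ n (unitCos a c i) := by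
  unfold unitCos cosMode; fun_prop

theorem setIntegral_unitCos_mul (hac : a < c) (i j : ℕ) :
    ∫ x in Ioo a c, unitCos a c i x * unitCos a c j x = if i = j then 1 else 0 := by
  have : ∀ x, unitCos a c i x * unitCos a c j x
      = ((√(cosNormSq a c i))⁻¹ * (√(cosNormSq a c j))⁻¹) * (cosMode a c i x * cosMode a c j x) :=
    fun x => by unfold unitCos; ring
  simp only [this]
  rw [integral_const_mul, setIntegral_cosMode_mul hac]
  split_ifs with h
  · subst h
    have := cosNormSq_pos hac i
    rw [← mul_inv, Real.mul_self_sqrt this.le, inv_mul_cancel₀ this.ne']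
  · rw [mul_zero]

theorem abs_unitCos_le (hac : a < c) (i : ℕ) (x : ℝ) :
    |unitCos a c i x| ≤ (√((c - a) / 2))⁻¹ := by
  have h0 : 0 < (c - a) / 2 := by linarith
  rw [unitCos, abs_mul, abs_inv, abs_of_nonneg (Real.sqrt_nonneg _)]
  calc _ ≤ (√(cosNormSq a c i))⁻¹ * 1 :=
        mul_le_mul_of_nonneg_left (Real.abs_cos_le_one _) (by positivity)
    _ ≤ _ := by
        rw [mul_one]
        exact inv_anti₀ (Real.sqrt_pos.2 h0) (Real.sqrt_le_sqrt (half_le_cosNormSq hac i))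

/-- The first cosine runs through a single half period, on which the cosine is injective. It alone
separates the points of the closed interval, end points included. -/
theorem cosMode_one_injOn (hac : a < c) : InjOn (cosMode a c 1) (Icc a c) := by
  intro x hx y hy h
  have hl : 0 < c - a := by linarith
  have hf : ∀ z ∈ Icc a c, freq a c 1 * (z - a) ∈ Icc 0 Real.pi := by
    intro z hz
    have hp := Real.pi_pos
    have h1 : 0 ≤ z - a := by linarith [hz.1]
    have h2 : z - a ≤ c - a := by linarith [hz.2]
    unfold freq
    refine ⟨by positivity, ?_⟩
    rw [Nat.cast_one, one_mul, div_mul_eq_mul_div, div_le_iff₀ hl]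
    gcongr
  have h1 := Real.injOn_cos (hf x hx) (hf y hy) h
  have : freq a c 1 ≠ 0 := by
    have := Real.pi_pos
    unfold freq; positivity
  have := mul_left_cancel₀ this h1
  linarith

theorem summable_inv_one_add_freq_sq (hac : a < c) :
    Summable fun i => (1 + freq a c i ^ 2)⁻¹ := by
  have hs : Summable fun i : ℕ => ((c - a) / Real.pi) ^ 2 * ((i : ℝ) ^ 2)⁻¹ :=
    (Real.summable_nat_pow_inv.2 one_lt_two).mul_left _
  refine Summable.of_norm_bounded_eventually_nat hs ?_
  filter_upwards [eventually_ge_atTop 1] with i hi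
  have hi' : (0 : ℝ) < i := by exact_mod_cast hi
  have hl : 0 < c - a := by linarith
  have hp := Real.pi_pos
  have hfr : 0 < freq a c i := by unfold freq; positivity
  rw [Real.norm_eq_abs, abs_of_pos (by positivity)]
  calc (1 + freq a c i ^ 2)⁻¹ ≤ (freq a c i ^ 2)⁻¹ := inv_anti₀ (by positivity) (by linarith)
    _ = _ := by unfold freq; field_simp

end Cosines

/-! ### Completeness of the cosines on a rectangle and point values -/

section Rectangle

variable {a₁ c₁ a₂ c₂ : ℝ}

theorem rect_subset_Icc : rect a₁ c₁ a₂ c₂ ⊆ Icc a₁ c₁ ×ˢ Icc a₂ c₂ :=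
  prod_mono Ioo_subset_Icc_self Ioo_subset_Icc_self

theorem isCompact_Icc_prod : IsCompact (Icc a₁ c₁ ×ˢ Icc a₂ c₂ : Set (ℝ × ℝ)) :=
  isCompact_Icc.prod isCompact_Icc

theorem isOpen_rect : IsOpen (rect a₁ c₁ a₂ c₂) := isOpen_Ioo.prod isOpen_Ioo

theorem memLp_rect {P : ℝ × ℝ → ℝ} (hP : Continuous P) :
    MemLp P 2 ((volume : Measure (ℝ × ℝ)).restrict (rect a₁ c₁ a₂ c₂)) := by
  rw [memLp_two_iff_integrable_sq hP.aestronglyMeasurable]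
  exact (((hP.pow 2).continuousOn.integrableOn_compact isCompact_Icc_prod).mono_set
    rect_subset_Icc)

/-- The class in `L²` of a function that is continuous on the plane. -/
def contL2 (a₁ c₁ a₂ c₂ : ℝ) (P : ℝ × ℝ → ℝ) (hP : Continuous P) : L2 (rect a₁ c₁ a₂ c₂) :=
  (memLp_rect hP).toLp P

theorem contL2_ae {P : ℝ × ℝ → ℝ} (hP : Continuous P) :
    contL2 a₁ c₁ a₂ c₂ P hP =ᵐ[(volume : Measure (ℝ × ℝ)).restrict (rect a₁ c₁ a₂ c₂)] P :=
  MemLp.coeFn_toLp _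

theorem inner_eq_setIntegral {Ω : Set (ℝ × ℝ)} (u v : L2 Ω) :
    inner ℝ u v = ∫ x in Ω, u x * v x := by
  rw [L2.inner_def]
  exact integral_congr_ae (Eventually.of_forall fun x => by simp [mul_comm])

theorem inner_contL2 {P : ℝ × ℝ → ℝ} (hP : Continuous P) (u : L2 (rect a₁ c₁ a₂ c₂)) :
    inner ℝ (contL2 a₁ c₁ a₂ c₂ P hP) u = ∫ x in rect a₁ c₁ a₂ c₂, u x * P x := by
  rw [inner_eq_setIntegral]
  refine integral_congr_ae ?_
  filter_upwards [contL2_ae hP] with x hx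
  rw [hx, mul_comm]

theorem integrable_mul_of_continuous {P : ℝ × ℝ → ℝ} (hP : Continuous P)
    (u : L2 (rect a₁ c₁ a₂ c₂)) :
    Integrable (fun x => u x * P x) ((volume : Measure (ℝ × ℝ)).restrict (rect a₁ c₁ a₂ c₂)) :=
  (Lp.memLp u).integrable_mul (q := 2) (memLp_rect hP)

theorem integrable_L2_rect (u : L2 (rect a₁ c₁ a₂ c₂)) :
    Integrable u ((volume : Measure (ℝ × ℝ)).restrict (rect a₁ c₁ a₂ c₂)) := by
  simpa using integrable_mul_of_continuous (P := fun _ => 1) continuous_const u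

/-- An `L²` function that is orthogonal to all test functions vanishes. -/
theorem eq_zero_of_integral_test {u : L2 (rect a₁ c₁ a₂ c₂)}
    (h : ∀ φ, IsTest (rect a₁ c₁ a₂ c₂) φ → ∫ x in rect a₁ c₁ a₂ c₂, u x * φ x = 0) : u = 0 := by
  have h1 : ∀ᵐ x ∂(volume : Measure (ℝ × ℝ)), x ∈ rect a₁ c₁ a₂ c₂ → u x = 0 := by
    refine isOpen_rect.ae_eq_zero_of_integral_contDiff_smul_eq_zero
      (IntegrableOn.locallyIntegrableOn (integrable_L2_rect u)) fun g hg hgc hgs => ?_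
    rw [← h g ⟨hg, hgc, hgs⟩, ← setIntegral_eq_integral_of_forall_compl_eq_zero
      (s := rect a₁ c₁ a₂ c₂)]
    · simp only [smul_eq_mul, mul_comm]
    · intro x hx
      rw [image_eq_zero_of_notMem_tsupport (fun h' => hx (hgs h')), zero_smul]
  rw [Lp.eq_zero_iff_ae_eq_zero, Filter.EventuallyEq, ae_restrict_iff' isOpen_rect.measurableSet]
  exact h1

/-- A product of one-dimensional cosines on the closed rectangle. -/
def cosProd (a₁ c₁ a₂ c₂ : ℝ) (p : ℕ × ℕ) : C((Icc a₁ c₁ ×ˢ Icc a₂ c₂ : Set (ℝ × ℝ)), ℝ) where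
  toFun x := cosMode a₁ c₁ p.1 x.1.1 * cosMode a₂ c₂ p.2 x.1.2
  continuous_toFun := by
    have := continuous_cosMode a₁ c₁ p.1
    have := continuous_cosMode a₂ c₂ p.2
    fun_prop

theorem cosProd_mul (p q : ℕ × ℕ) : cosProd a₁ c₁ a₂ c₂ p * cosProd a₁ c₁ a₂ c₂ q =
    (1 / 4 : ℝ) • (cosProd a₁ c₁ a₂ c₂ (p.1 + q.1, p.2 + q.2)
      + cosProd a₁ c₁ a₂ c₂ (p.1 + q.1, ((p.2 : ℤ) - q.2).natAbs)
      + cosProd a₁ c₁ a₂ c₂ (((p.1 : ℤ) - q.1).natAbs, p.2 + q.2)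
      + cosProd a₁ c₁ a₂ c₂ (((p.1 : ℤ) - q.1).natAbs, ((p.2 : ℤ) - q.2).natAbs)) := by
  ext x
  have h1 := cosMode_mul a₁ c₁ p.1 q.1 x.1.1
  have h2 := cosMode_mul a₂ c₂ p.2 q.2 x.1.2
  simp only [cosProd, ContinuousMap.mul_apply, ContinuousMap.coe_mk, ContinuousMap.smul_apply,
    ContinuousMap.add_apply, smul_eq_mul]
  rw [mul_mul_mul_comm, h1, h2]
  ring

/-- The algebra spanned by the products of cosines. -/
def cosAlgebra (a₁ c₁ a₂ c₂ : ℝ) :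
    Subalgebra ℝ C((Icc a₁ c₁ ×ˢ Icc a₂ c₂ : Set (ℝ × ℝ)), ℝ) :=
  (Submodule.span ℝ (range (cosProd a₁ c₁ a₂ c₂))).toSubalgebra
    (Submodule.subset_span ⟨(0, 0), by ext x; simp [cosProd, cosMode_zero]⟩)
    (fun f g hf hg => by
      have h := Submodule.mul_mem_mul hf hg
      rw [Submodule.span_mul_span] at h
      refine Submodule.span_le.2 ?_ h
      rintro _ ⟨_, ⟨p, rfl⟩, _, ⟨q, rfl⟩, rfl⟩
      change cosProd a₁ c₁ a₂ c₂ p * cosProd a₁ c₁ a₂ c₂ q ∈ _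
      rw [cosProd_mul]
      refine Submodule.smul_mem _ _ ?_
      refine Submodule.add_mem _ (Submodule.add_mem _ (Submodule.add_mem _ ?_ ?_) ?_) ?_ <;>
        exact Submodule.subset_span ⟨_, rfl⟩)

theorem separatesPoints_cosAlgebra (h₁ : a₁ < c₁) (h₂ : a₂ < c₂) :
    (cosAlgebra a₁ c₁ a₂ c₂).SeparatesPoints := by
  intro x y hxy
  by_contra hcon
  push Not at hcon
  have hx := x.2
  have hy := y.2
  have e : ∀ p, cosProd a₁ c₁ a₂ c₂ p x = cosProd a₁ c₁ a₂ c₂ p y := fun p =>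
    hcon _ ⟨cosProd a₁ c₁ a₂ c₂ p, Submodule.subset_span ⟨p, rfl⟩, rfl⟩
  have e1 : x.1.1 = y.1.1 := by
    have := e (1, 0)
    simp only [cosProd, ContinuousMap.coe_mk, cosMode_zero, mul_one] at this
    exact cosMode_one_injOn h₁ hx.1 hy.1 this
  have e2 : x.1.2 = y.1.2 := by
    have := e (0, 1)
    simp only [cosProd, ContinuousMap.coe_mk, cosMode_zero, one_mul] at this
    exact cosMode_one_injOn h₂ hx.2 hy.2 this
  exact hxy (Subtype.ext (Prod.ext e1 e2))

/-- Completeness of the cosines in `L²` of a rectangle. -/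
theorem eq_zero_of_integral_cosMode (h₁ : a₁ < c₁) (h₂ : a₂ < c₂) {u : L2 (rect a₁ c₁ a₂ c₂)}
    (h : ∀ p : ℕ × ℕ, ∫ x in rect a₁ c₁ a₂ c₂,
      u x * (cosMode a₁ c₁ p.1 x.1 * cosMode a₂ c₂ p.2 x.2) = 0) : u = 0 := by
  have hspan : ∀ g ∈ Submodule.span ℝ (range (cosProd a₁ c₁ a₂ c₂)), ∃ P : ℝ × ℝ → ℝ,
      Continuous P ∧ (∀ x, g x = P x) ∧ ∫ x in rect a₁ c₁ a₂ c₂, u x * P x = 0 := by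
    intro g hg
    induction hg using Submodule.span_induction with
    | mem g hg =>
      obtain ⟨p, rfl⟩ := hg
      have := continuous_cosMode a₁ c₁ p.1
      have := continuous_cosMode a₂ c₂ p.2
      exact ⟨fun x => cosMode a₁ c₁ p.1 x.1 * cosMode a₂ c₂ p.2 x.2, by fun_prop,
        fun x => rfl, h p⟩
    | zero => exact ⟨fun _ => 0, continuous_const, fun x => rfl, by simp⟩
    | add f g _ _ hf hg =>
      obtain ⟨P, hP, hfP, hP0⟩ := hf
      obtain ⟨Q, hQ, hgQ, hQ0⟩ := hg
      refine ⟨fun x => P x + Q x, hP.add hQ, fun x => by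
        rw [ContinuousMap.add_apply, hfP, hgQ], ?_⟩
      simp only [mul_add]
      rw [integral_add (integrable_mul_of_continuous hP u) (integrable_mul_of_continuous hQ u),
        hP0, hQ0, add_zero]
    | smul r f _ hf =>
      obtain ⟨P, hP, hfP, hP0⟩ := hf
      refine ⟨fun x => r * P x, continuous_const.mul hP, fun x => by
        rw [ContinuousMap.smul_apply, hfP, smul_eq_mul], ?_⟩
      simp only [mul_left_comm _ r]
      rw [integral_const_mul, hP0, mul_zero]
  -- Test functions are uniform limits of cosine polynomials, and `u` is integrable on the bounded
  -- rectangle, so orthogonality to cosines passes to test functions.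
  refine eq_zero_of_integral_test fun φ hφ => ?_
  have hφc := hφ.smooth.continuous
  have hui := (integrable_L2_rect u).norm
  set I := ∫ x in rect a₁ c₁ a₂ c₂, ‖u x‖ with hI
  have hI0 : 0 ≤ I := integral_nonneg fun x => norm_nonneg _
  have hsmall : ∀ ε : ℝ, 0 < ε → |∫ x in rect a₁ c₁ a₂ c₂, u x * φ x| ≤ ε * I := by
    intro ε hε
    have : CompactSpace (Icc a₁ c₁ ×ˢ Icc a₂ c₂ : Set (ℝ × ℝ)) :=
      isCompact_iff_compactSpace.1 isCompact_Icc_prod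
    obtain ⟨⟨g, hg⟩, hgε⟩ := ContinuousMap.exists_mem_subalgebra_near_continuous_of_separatesPoints
      (cosAlgebra a₁ c₁ a₂ c₂) (separatesPoints_cosAlgebra h₁ h₂)
      (fun x => φ x) (hφc.comp continuous_subtype_val) ε hε
    obtain ⟨P, hP, hgP, hP0⟩ := hspan g hg
    have e1 : ∫ x in rect a₁ c₁ a₂ c₂, u x * φ x
        = ∫ x in rect a₁ c₁ a₂ c₂, (u x * φ x - u x * P x) := by
      rw [integral_sub (integrable_mul_of_continuous hφc u) (integrable_mul_of_continuous hP u),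
        hP0, sub_zero]
    rw [e1, ← Real.norm_eq_abs, hI, ← integral_const_mul]
    refine norm_integral_le_of_norm_le (hui.const_mul ε) ?_
    filter_upwards [ae_restrict_mem isOpen_rect.measurableSet] with x hx
    have := hgε ⟨x, rect_subset_Icc hx⟩
    simp only [hgP] at this
    rw [← mul_sub, norm_mul, mul_comm, norm_sub_rev]
    exact mul_le_mul_of_nonneg_right this.le (norm_nonneg _)
  by_contra hne
  have hpos := abs_pos.2 hne
  -- With this accuracy the integral would be at most half of its own modulus; I + 1 replaces I
  -- because I may vanish.
  have := hsmall (|∫ x in rect a₁ c₁ a₂ c₂, u x * φ x| / (2 * (I + 1))) (by positivity)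
  rw [div_mul_eq_mul_div, le_div_iff₀ (by positivity)] at this
  nlinarith

/-- The Neumann modes of a rectangle, normalised in `L²`. -/
def mode (a₁ c₁ a₂ c₂ : ℝ) (p : ℕ × ℕ) (x : ℝ × ℝ) : ℝ :=
  unitCos a₁ c₁ p.1 x.1 * unitCos a₂ c₂ p.2 x.2

theorem contDiff_mode (a₁ c₁ a₂ c₂ : ℝ) (p : ℕ × ℕ) {n : WithTop ℕ∞} :
    ContDiff ℝ n (mode a₁ c₁ a₂ c₂ p) :=
  ((contDiff_unitCos a₁ c₁ p.1).comp contDiff_fst).mul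
    ((contDiff_unitCos a₂ c₂ p.2).comp contDiff_snd)

theorem continuous_mode (a₁ c₁ a₂ c₂ : ℝ) (p : ℕ × ℕ) : Continuous (mode a₁ c₁ a₂ c₂ p) :=
  (contDiff_mode a₁ c₁ a₂ c₂ p (n := 0)).continuous

theorem abs_mode_le (h₁ : a₁ < c₁) (h₂ : a₂ < c₂) (p : ℕ × ℕ) (x : ℝ × ℝ) :
    |mode a₁ c₁ a₂ c₂ p x| ≤ (√((c₁ - a₁) / 2))⁻¹ * (√((c₂ - a₂) / 2))⁻¹ := by
  rw [mode, abs_mul]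
  exact mul_le_mul (abs_unitCos_le h₁ _ _) (abs_unitCos_le h₂ _ _) (abs_nonneg _) (by positivity)

/-- The Neumann modes as elements of `L²`. -/
def modeL2 (a₁ c₁ a₂ c₂ : ℝ) (p : ℕ × ℕ) : L2 (rect a₁ c₁ a₂ c₂) :=
  contL2 a₁ c₁ a₂ c₂ (mode a₁ c₁ a₂ c₂ p) (continuous_mode a₁ c₁ a₂ c₂ p)

theorem setIntegral_mode_mul (h₁ : a₁ < c₁) (h₂ : a₂ < c₂) (p q : ℕ × ℕ) :
    ∫ x in rect a₁ c₁ a₂ c₂, mode a₁ c₁ a₂ c₂ p x * mode a₁ c₁ a₂ c₂ q x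
      = if p = q then 1 else 0 := by
  have : ∀ x : ℝ × ℝ, mode a₁ c₁ a₂ c₂ p x * mode a₁ c₁ a₂ c₂ q x
      = (unitCos a₁ c₁ p.1 x.1 * unitCos a₁ c₁ q.1 x.1)
        * (unitCos a₂ c₂ p.2 x.2 * unitCos a₂ c₂ q.2 x.2) := fun x => by unfold mode; ring
  simp only [this]
  rw [rect, Measure.volume_eq_prod, setIntegral_prod_mul
    (fun x => unitCos a₁ c₁ p.1 x * unitCos a₁ c₁ q.1 x)
    (fun x => unitCos a₂ c₂ p.2 x * unitCos a₂ c₂ q.2 x),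
    setIntegral_unitCos_mul h₁, setIntegral_unitCos_mul h₂]
  simp only [Prod.ext_iff]
  split_ifs <;> simp_all

theorem orthonormal_modeL2 (h₁ : a₁ < c₁) (h₂ : a₂ < c₂) :
    Orthonormal ℝ (modeL2 a₁ c₁ a₂ c₂) := by
  rw [orthonormal_iff_ite]
  intro p q
  rw [← setIntegral_mode_mul h₁ h₂ p q, modeL2, inner_contL2]
  refine integral_congr_ae ?_
  filter_upwards [contL2_ae (continuous_mode a₁ c₁ a₂ c₂ q)] with x hx
  rw [modeL2, hx, mul_comm]

/-- The Neumann modes form a Hilbert basis of `L²`. -/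
def modeBasis (h₁ : a₁ < c₁) (h₂ : a₂ < c₂) : HilbertBasis (ℕ × ℕ) ℝ (L2 (rect a₁ c₁ a₂ c₂)) :=
  HilbertBasis.mkOfOrthogonalEqBot (orthonormal_modeL2 h₁ h₂) <| by
    rw [Submodule.eq_bot_iff]
    intro u hu
    rw [Submodule.mem_orthogonal] at hu
    refine eq_zero_of_integral_cosMode h₁ h₂ fun p => ?_
    have h := hu (modeL2 a₁ c₁ a₂ c₂ p) (Submodule.subset_span ⟨p, rfl⟩)
    rw [modeL2, inner_contL2] at h
    have e : ∀ x : ℝ × ℝ, u x * mode a₁ c₁ a₂ c₂ p x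
        = ((√(cosNormSq a₁ c₁ p.1))⁻¹ * (√(cosNormSq a₂ c₂ p.2))⁻¹) *
          (u x * (cosMode a₁ c₁ p.1 x.1 * cosMode a₂ c₂ p.2 x.2)) := fun x => by
      unfold mode unitCos; ring
    simp only [e] at h
    rw [integral_const_mul] at h
    have n1 := Real.sqrt_pos.2 (cosNormSq_pos h₁ p.1)
    have n2 := Real.sqrt_pos.2 (cosNormSq_pos h₂ p.2)
    exact (mul_eq_zero.1 h).resolve_left (by positivity)

theorem coe_modeBasis (h₁ : a₁ < c₁) (h₂ : a₂ < c₂) (p : ℕ × ℕ) :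
    modeBasis h₁ h₂ p = modeL2 a₁ c₁ a₂ c₂ p := by
  rw [modeBasis, HilbertBasis.coe_mkOfOrthogonalEqBot]

theorem coord_modeBasis (h₁ : a₁ < c₁) (h₂ : a₂ < c₂) (p : ℕ × ℕ) (u : L2 (rect a₁ c₁ a₂ c₂)) :
    coord (modeBasis h₁ h₂) p u = ∫ x in rect a₁ c₁ a₂ c₂, u x * mode a₁ c₁ a₂ c₂ p x := by
  rw [coord_apply, coe_modeBasis, modeL2, inner_contL2]

/-- The decay rates of the Neumann modes. -/
def modeRate (a₁ c₁ a₂ c₂ : ℝ) (p : ℕ × ℕ) : ℝ := freq a₁ c₁ p.1 ^ 2 + freq a₂ c₂ p.2 ^ 2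

/-- Since (1 + A)(1 + B) ≤ (1 + A + B)² for nonnegative A and B, the double series is dominated by a
product of two convergent simple ones. -/
theorem summable_modeRate (h₁ : a₁ < c₁) (h₂ : a₂ < c₂) :
    Summable fun p => ((1 + modeRate a₁ c₁ a₂ c₂ p) ^ 2)⁻¹ := by
  refine Summable.of_nonneg_of_le (fun p => by positivity) (fun p => ?_)
    ((summable_inv_one_add_freq_sq h₁).mul_of_nonneg (summable_inv_one_add_freq_sq h₂)
      (fun i => by positivity) (fun i => by positivity))
  rw [← mul_inv]
  refine inv_anti₀ (by positivity) ?_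
  unfold modeRate
  nlinarith [sq_nonneg (freq a₁ c₁ p.1), sq_nonneg (freq a₂ c₂ p.2),
    mul_nonneg (sq_nonneg (freq a₁ c₁ p.1)) (sq_nonneg (freq a₂ c₂ p.2)),
    sq_nonneg (freq a₁ c₁ p.1 ^ 2), sq_nonneg (freq a₂ c₂ p.2 ^ 2)]

/-- Uniqueness of the value of the continuous representative. -/
theorem HasPointValue.unique {u : L2 (rect a₁ c₁ a₂ c₂)} {b : ℝ × ℝ}
    (hb : b ∈ closure (rect a₁ c₁ a₂ c₂)) {y y' : ℝ} (h : HasPointValue u b y)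
    (h' : HasPointValue u b y') : y = y' := by
  obtain ⟨g, hg, hug, rfl⟩ := h
  obtain ⟨g', hg', hug', rfl⟩ := h'
  have h1 : EqOn g g' (rect a₁ c₁ a₂ c₂) :=
    Measure.eqOn_open_of_ae_eq (hug.symm.trans hug') isOpen_rect (hg.mono subset_closure)
      (hg'.mono subset_closure)
  exact h1.of_subset_closure hg hg' subset_closure le_rfl hb

/-- A function with summable coefficients has a continuous representative, given by its series. -/
theorem hasPointValue_of_summable (h₁ : a₁ < c₁) (h₂ : a₂ < c₂) {u : L2 (rect a₁ c₁ a₂ c₂)}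
    (hu : Summable fun p => |coord (modeBasis h₁ h₂) p u|) (b : ℝ × ℝ) :
    HasPointValue u b (∑' p, mode a₁ c₁ a₂ c₂ p b * coord (modeBasis h₁ h₂) p u) := by
  set B := (√((c₁ - a₁) / 2))⁻¹ * (√((c₂ - a₂) / 2))⁻¹
  set g : ℝ × ℝ → ℝ := fun x => ∑' p, mode a₁ c₁ a₂ c₂ p x * coord (modeBasis h₁ h₂) p u with hgdef
  have hbd : ∀ p x, ‖mode a₁ c₁ a₂ c₂ p x * coord (modeBasis h₁ h₂) p u‖
      ≤ B * |coord (modeBasis h₁ h₂) p u| := fun p x => by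
    rw [norm_mul]
    exact mul_le_mul_of_nonneg_right (abs_mode_le h₁ h₂ p x) (abs_nonneg _)
  have hg : Continuous g :=
    continuous_tsum (fun p => (continuous_mode a₁ c₁ a₂ c₂ p).mul continuous_const)
      (hu.mul_left B) hbd
  refine ⟨g, hg.continuousOn, ?_, rfl⟩
  -- The continuous sum and `u` have the same coefficients: the series may be integrated term by
  -- term against each mode, by absolute summability and the uniform bound on the modes.
  have key : contL2 a₁ c₁ a₂ c₂ g hg = u := by
    refine repr_ext (modeBasis h₁ h₂) fun q => ?_
    rw [coord_modeBasis]
    have e1 : ∫ x in rect a₁ c₁ a₂ c₂, contL2 a₁ c₁ a₂ c₂ g hg x * mode a₁ c₁ a₂ c₂ q x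
        = ∫ x in rect a₁ c₁ a₂ c₂, ∑' p, coord (modeBasis h₁ h₂) p u *
          (mode a₁ c₁ a₂ c₂ p x * mode a₁ c₁ a₂ c₂ q x) := by
      refine integral_congr_ae ?_
      filter_upwards [contL2_ae hg] with x hx
      rw [hx, hgdef, ← tsum_mul_right]
      exact tsum_congr fun p => by ring
    have hint : ∀ p, Integrable (fun x => coord (modeBasis h₁ h₂) p u *
        (mode a₁ c₁ a₂ c₂ p x * mode a₁ c₁ a₂ c₂ q x))
        ((volume : Measure (ℝ × ℝ)).restrict (rect a₁ c₁ a₂ c₂)) := fun p =>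
      ((memLp_rect (continuous_mode a₁ c₁ a₂ c₂ p)).integrable_mul (q := 2)
        (memLp_rect (continuous_mode a₁ c₁ a₂ c₂ q))).const_mul _
    have hfin : (volume : Measure (ℝ × ℝ)) (rect a₁ c₁ a₂ c₂) ≠ ⊤ :=
      ((measure_mono rect_subset_Icc).trans_lt isCompact_Icc_prod.measure_lt_top).ne
    have hsum : Summable fun p => ∫ x in rect a₁ c₁ a₂ c₂, ‖coord (modeBasis h₁ h₂) p u *
        (mode a₁ c₁ a₂ c₂ p x * mode a₁ c₁ a₂ c₂ q x)‖ := by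
      refine Summable.of_nonneg_of_le (fun p => integral_nonneg fun x => norm_nonneg _)
        (fun p => ?_) (hu.mul_left (B * B * volume.real (rect a₁ c₁ a₂ c₂)))
      have hb1 : ∀ x ∈ rect a₁ c₁ a₂ c₂, ‖‖coord (modeBasis h₁ h₂) p u *
          (mode a₁ c₁ a₂ c₂ p x * mode a₁ c₁ a₂ c₂ q x)‖‖
            ≤ |coord (modeBasis h₁ h₂) p u| * (B * B) := fun x _ => by
        rw [norm_norm, norm_mul, norm_mul]
        refine mul_le_mul_of_nonneg_left ?_ (norm_nonneg _)
        exact mul_le_mul (abs_mode_le h₁ h₂ p x) (abs_mode_le h₁ h₂ q x) (norm_nonneg _)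
          (by positivity)
      have := norm_setIntegral_le_of_norm_le_const hfin.lt_top hb1
      rw [Real.norm_eq_abs] at this
      refine (le_abs_self _).trans (this.trans_eq ?_)
      ring
    rw [e1, ← integral_tsum_of_summable_integral_norm hint hsum]
    simp only [integral_const_mul, setIntegral_mode_mul h₁ h₂]
    rw [tsum_eq_single q (fun p hp => by rw [if_neg hp, mul_zero]), if_pos rfl, mul_one]
  rw [← key]
  exact contL2_ae hg

end Rectangle

/-! ### A smooth cutoff -/

section Cutoff

/-- A smooth function that vanishes on `]-∞, 1]` and equals one on `[2, ∞[`. -/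
def cutoff (r : ℝ) : ℝ := Real.smoothTransition (r - 1)

theorem contDiff_cutoff {n : ℕ∞} : ContDiff ℝ n cutoff :=
  Real.smoothTransition.contDiff.comp (contDiff_id.sub contDiff_const)

theorem cutoff_of_le_one {r : ℝ} (h : r ≤ 1) : cutoff r = 0 :=
  Real.smoothTransition.zero_of_nonpos (by linarith)

theorem cutoff_of_two_le {r : ℝ} (h : 2 ≤ r) : cutoff r = 1 :=
  Real.smoothTransition.one_of_one_le (by linarith)

theorem abs_cutoff_le (r : ℝ) : |cutoff r| ≤ 1 := by
  rw [cutoff, abs_of_nonneg (Real.smoothTransition.nonneg _)]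
  exact Real.smoothTransition.le_one _

theorem hasDerivAt_cutoff (r : ℝ) : HasDerivAt cutoff (deriv cutoff r) r :=
  ((contDiff_cutoff (n := 1)).differentiable (by simp) r).hasDerivAt

theorem deriv_cutoff_of_two_lt {r : ℝ} (h : 2 < r) : deriv cutoff r = 0 := by
  have : cutoff =ᶠ[𝓝 r] fun _ => 1 := by
    filter_upwards [lt_mem_nhds h] with s hs using cutoff_of_two_le hs.le
  rw [this.deriv_eq, deriv_const]

theorem deriv_cutoff_of_lt_one {r : ℝ} (h : r < 1) : deriv cutoff r = 0 := by
  have : cutoff =ᶠ[𝓝 r] fun _ => 0 := by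
    filter_upwards [gt_mem_nhds h] with s hs using cutoff_of_le_one hs.le
  rw [this.deriv_eq, deriv_const]

/-- The gradient of `cutoff (n * D)` grows with n, but multiplied by the distance D it stays
bounded, because the derivative of the cutoff lives on [1, 2]. -/
theorem exists_bound_mul_deriv_cutoff : ∃ K : ℝ, 0 ≤ K ∧ ∀ r, |r * deriv cutoff r| ≤ K := by
  have hc : Continuous fun r => r * deriv cutoff r :=
    continuous_id.mul ((contDiff_cutoff (n := 1)).continuous_deriv (by simp))
  obtain ⟨K, hK⟩ := (isCompact_Icc (a := (1 : ℝ)) (b := 2)).exists_bound_of_continuousOn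
    hc.continuousOn
  refine ⟨max K 0, le_max_right _ _, fun r => ?_⟩
  by_cases h1 : r < 1
  · rw [deriv_cutoff_of_lt_one h1]; simp
  by_cases h2 : 2 < r
  · rw [deriv_cutoff_of_two_lt h2]; simp
  · exact (hK r ⟨not_lt.1 h1, not_lt.1 h2⟩).trans (le_max_left _ _)

end Cutoff

/-! ### Rules for partial derivatives -/

section PartialDeriv

/-- The `k`-th vector of the standard basis of the plane. -/
abbrev direction (k : Fin 2) : ℝ × ℝ :=
  (![((1 : ℝ), (0 : ℝ)), ((0 : ℝ), (1 : ℝ))] : Fin 2 → ℝ × ℝ) k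

theorem continuous_partialDeriv {φ : ℝ × ℝ → ℝ} (hφ : ContDiff ℝ 1 φ) (k : Fin 2) :
    Continuous (partialDeriv k φ) :=
  (hφ.continuous_fderiv (by simp)).clm_apply continuous_const

theorem partialDeriv_mul {f g : ℝ × ℝ → ℝ} {x : ℝ × ℝ} (k : Fin 2) (hf : DifferentiableAt ℝ f x)
    (hg : DifferentiableAt ℝ g x) : partialDeriv k (fun x => f x * g x) x =
      partialDeriv k f x * g x + f x * partialDeriv k g x := by
  have := (hf.hasFDerivAt.mul hg.hasFDerivAt).fderiv
  unfold partialDeriv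
  change (fderiv ℝ (f * g) x) _ = _
  rw [this]
  simp only [add_apply, smul_apply, smul_eq_mul]
  ring

theorem partialDeriv_comp {f : ℝ × ℝ → ℝ} {g : ℝ → ℝ} {g' : ℝ} {x : ℝ × ℝ} (k : Fin 2)
    (hf : DifferentiableAt ℝ f x) (hg : HasDerivAt g g' (f x)) :
    partialDeriv k (fun x => g (f x)) x = g' * partialDeriv k f x := by
  have := (hg.comp_hasFDerivAt x hf.hasFDerivAt).fderiv
  unfold partialDeriv
  change (fderiv ℝ (g ∘ f) x) _ = _
  rw [this]
  rfl

theorem partialDeriv_zero_prod {f g : ℝ → ℝ} {f' : ℝ} {x : ℝ × ℝ} (hf : HasDerivAt f f' x.1)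
    (hg : DifferentiableAt ℝ g x.2) :
    partialDeriv 0 (fun x => f x.1 * g x.2) x = f' * g x.2 := by
  have h := ((hf.comp_hasFDerivAt x (hasFDerivAt_fst (𝕜 := ℝ) (p := x))).mul
    (hg.hasDerivAt.comp_hasFDerivAt x (hasFDerivAt_snd (𝕜 := ℝ) (p := x)))).fderiv
  unfold partialDeriv
  change (fderiv ℝ ((f ∘ Prod.fst) * (g ∘ Prod.snd)) x) _ = _
  rw [h]
  simp [mul_comm]

theorem partialDeriv_one_prod {f g : ℝ → ℝ} {g' : ℝ} {x : ℝ × ℝ} (hf : DifferentiableAt ℝ f x.1)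
    (hg : HasDerivAt g g' x.2) :
    partialDeriv 1 (fun x => f x.1 * g x.2) x = f x.1 * g' := by
  have h := ((hf.hasDerivAt.comp_hasFDerivAt x (hasFDerivAt_fst (𝕜 := ℝ) (p := x))).mul
    (hg.comp_hasFDerivAt x (hasFDerivAt_snd (𝕜 := ℝ) (p := x)))).fderiv
  unfold partialDeriv
  change (fderiv ℝ ((f ∘ Prod.fst) * (g ∘ Prod.snd)) x) _ = _
  rw [h]
  simp

end PartialDeriv

/-! ### Integration by parts up to the boundary -/

section IntegrationByParts

variable {a₁ c₁ a₂ c₂ : ℝ}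

/-- Integration by parts against a smooth function that is not compactly supported, but vanishes
at the faces of the rectangle orthogonal to the direction `k`. The functions `D` and `D'` measure
the distances to the two pairs of faces. -/
theorem IsWeakPartial.integral_mul {k : Fin 2} {u g : L2 (rect a₁ c₁ a₂ c₂)}
    (h : IsWeakPartial k u g) {ψ D D' : ℝ × ℝ → ℝ}
    (hψ : ContDiff ℝ ((⊤ : ℕ∞) : WithTop ℕ∞) ψ) (hD : ContDiff ℝ ((⊤ : ℕ∞) : WithTop ℕ∞) D)
    (hD' : ContDiff ℝ ((⊤ : ℕ∞) : WithTop ℕ∞) D')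
    (hrect : ∀ x, x ∈ rect a₁ c₁ a₂ c₂ ↔ 0 < D x ∧ 0 < D' x)
    (hk : ∀ x, partialDeriv k D' x = 0) {C : ℝ}
    (hC : ∀ x ∈ rect a₁ c₁ a₂ c₂, |ψ x| ≤ C * D x) :
    ∫ x in rect a₁ c₁ a₂ c₂, u x * partialDeriv k ψ x = -∫ x in rect a₁ c₁ a₂ c₂, g x * ψ x := by
  obtain ⟨K, hK0, hK⟩ := exists_bound_mul_deriv_cutoff
  -- The cutoff removes a neighbourhood of all four faces. The factor in `D'` is not differentiated
  -- by `partialDeriv k`, so `ψ` has to vanish only at the faces measured by `D`.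
  set χ : ℕ → ℝ × ℝ → ℝ := fun n x => cutoff (n * D x) * cutoff (n * D' x) with hχ
  have hψ1 : ContDiff ℝ 1 ψ := hψ.of_le (by exact_mod_cast le_top)
  have hD1 : ContDiff ℝ 1 D := hD.of_le (by exact_mod_cast le_top)
  have hD1' : ContDiff ℝ 1 D' := hD'.of_le (by exact_mod_cast le_top)
  have hχs : ∀ n, ContDiff ℝ ((⊤ : ℕ∞) : WithTop ℕ∞) (χ n) := fun n =>
    (contDiff_cutoff.comp (contDiff_const.mul hD)).mul
      (contDiff_cutoff.comp (contDiff_const.mul hD'))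
  have hχd : ∀ n x, partialDeriv k (χ n) x
      = n * deriv cutoff (n * D x) * partialDeriv k D x * cutoff (n * D' x) := by
    intro n x
    have d1 : DifferentiableAt ℝ D x := hD1.differentiable (by simp) x
    have d1' : DifferentiableAt ℝ D' x := hD1'.differentiable (by simp) x
    have g1 : ∀ r : ℝ, HasDerivAt (fun r => cutoff (n * r)) (n * deriv cutoff (n * r)) r := by
      intro r
      have := (hasDerivAt_cutoff (n * r)).comp r ((hasDerivAt_id r).const_mul (n : ℝ))
      refine this.congr_deriv ?_
      ring
    rw [hχ]
    simp only
    rw [partialDeriv_mul k (f := fun x => cutoff (n * D x)) (g := fun x => cutoff (n * D' x))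
      ((g1 _).differentiableAt.comp x d1) ((g1 _).differentiableAt.comp x d1'),
      partialDeriv_comp k d1 (g1 (D x)), partialDeriv_comp k d1' (g1 (D' x)), hk]
    ring
  have htest : ∀ n : ℕ, 1 ≤ n → IsTest (rect a₁ c₁ a₂ c₂) (fun x => χ n x * ψ x) := by
    intro n hn
    have hn0 : (0 : ℝ) < n := by exact_mod_cast hn
    have hsub : {x | 1 ≤ n * D x} ∩ {x | 1 ≤ n * D' x} ⊆ rect a₁ c₁ a₂ c₂ := by
      rintro x ⟨h1, h2⟩
      rw [hrect]
      simp only [mem_ofPred_eq] at h1 h2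
      exact ⟨pos_of_mul_pos_right (lt_of_lt_of_le one_pos h1) hn0.le,
        pos_of_mul_pos_right (lt_of_lt_of_le one_pos h2) hn0.le⟩
    have hcl : IsClosed ({x | 1 ≤ n * D x} ∩ {x | 1 ≤ n * D' x}) :=
      (isClosed_le continuous_const (continuous_const.mul hD.continuous)).inter
        (isClosed_le continuous_const (continuous_const.mul hD'.continuous))
    have hts : tsupport (fun x => χ n x * ψ x) ⊆ {x | 1 ≤ n * D x} ∩ {x | 1 ≤ n * D' x} := by
      refine closure_minimal (fun x hx => ?_) hcl
      by_contra hcon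
      apply hx
      simp only [mem_inter_iff, mem_ofPred_eq, not_and_or, not_le] at hcon
      rcases hcon with h1 | h1
      · simp only [hχ, cutoff_of_le_one h1.le, zero_mul]
      · simp only [hχ, cutoff_of_le_one h1.le, mul_zero, zero_mul]
    exact ⟨(hχs n).mul hψ, isCompact_Icc_prod.of_isClosed_subset (isClosed_tsupport _)
      (hts.trans (hsub.trans rect_subset_Icc)), hts.trans hsub⟩
  have hlarge : ∀ x ∈ rect a₁ c₁ a₂ c₂, ∀ᶠ n : ℕ in atTop, 2 < n * D x ∧ 2 < n * D' x := by
    intro x hx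
    rw [hrect] at hx
    exact ((tendsto_natCast_atTop_atTop.atTop_mul_const hx.1).eventually_gt_atTop 2).and
      ((tendsto_natCast_atTop_atTop.atTop_mul_const hx.2).eventually_gt_atTop 2)
  have hder : ∀ n x, partialDeriv k (fun x => χ n x * ψ x) x
      = n * deriv cutoff (n * D x) * partialDeriv k D x * cutoff (n * D' x) * ψ x
        + χ n x * partialDeriv k ψ x := by
    intro n x
    rw [partialDeriv_mul k (((hχs n).differentiable (by simp)) x)
      (hψ1.differentiable (by simp) x), hχd]
  have hχ1 : ∀ n x, |χ n x| ≤ 1 := fun n x => by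
    simp only [hχ, abs_mul]
    exact mul_le_one₀ (abs_cutoff_le _) (abs_nonneg _) (abs_cutoff_le _)
  have lim1 : Tendsto (fun n : ℕ => ∫ x in rect a₁ c₁ a₂ c₂,
      u x * partialDeriv k (fun x => χ n x * ψ x) x) atTop
      (𝓝 (∫ x in rect a₁ c₁ a₂ c₂, u x * partialDeriv k ψ x)) := by
    refine tendsto_integral_of_dominated_convergence
      (fun x => |u x * (C * K * |partialDeriv k D x| + |partialDeriv k ψ x|)|)
      (fun n => ?_) ?_ (fun n => ?_) ?_
    · have : Continuous (partialDeriv k (fun x => χ n x * ψ x)) :=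
        continuous_partialDeriv (((hχs n).mul hψ).of_le (by exact_mod_cast le_top)) k
      exact (integrable_mul_of_continuous this u).aestronglyMeasurable
    · have h1 := continuous_partialDeriv hD1 k
      have h2 := continuous_partialDeriv hψ1 k
      exact (integrable_mul_of_continuous
        (P := fun x => C * K * |partialDeriv k D x| + |partialDeriv k ψ x|) (by fun_prop) u).abs
    · filter_upwards [ae_restrict_mem isOpen_rect.measurableSet] with x hx
      rw [hder, Real.norm_eq_abs, abs_mul, abs_mul (u x)]
      refine mul_le_mul_of_nonneg_left ((abs_add_le _ _).trans ?_) (abs_nonneg _)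
      refine le_trans ?_ (le_abs_self _)
      refine add_le_add ?_ ?_
      · have hDx := ((hrect x).1 hx).1
        have hCx := hC x hx
        have e : |(n : ℝ) * deriv cutoff (n * D x) * partialDeriv k D x * cutoff (n * D' x) * ψ x|
            = |(n : ℝ) * deriv cutoff (n * D x)| * |partialDeriv k D x| * |cutoff (n * D' x)|
              * |ψ x| := by simp only [abs_mul]
        rw [e]
        have hKx := hK (n * D x)
        -- At this point D is positive while C · D bounds an absolute value.
        have hC0 : 0 ≤ C := by
          by_contra hneg
          have := abs_nonneg (ψ x)
          nlinarith
        calc _ ≤ |(n : ℝ) * deriv cutoff (n * D x)| * |partialDeriv k D x| * 1 * (C * D x) := by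
              gcongr
              exact abs_cutoff_le _
          _ = C * |(n : ℝ) * D x * deriv cutoff (n * D x)| * |partialDeriv k D x| := by
              rw [abs_mul (n : ℝ) (deriv _ _), abs_mul ((n : ℝ) * D x), abs_mul (n : ℝ) (D x),
                abs_of_pos hDx]
              ring
          _ ≤ C * K * |partialDeriv k D x| := by gcongr
      · rw [abs_mul]
        exact mul_le_of_le_one_left (abs_nonneg _) (hχ1 n x)
    · filter_upwards [ae_restrict_mem isOpen_rect.measurableSet] with x hx
      refine tendsto_const_nhds.congr' ?_
      filter_upwards [hlarge x hx] with n hn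
      rw [hder, deriv_cutoff_of_two_lt hn.1]
      simp only [hχ, cutoff_of_two_le hn.1.le, cutoff_of_two_le hn.2.le]
      ring
  have lim2 : Tendsto (fun n : ℕ => -∫ x in rect a₁ c₁ a₂ c₂, g x * (χ n x * ψ x)) atTop
      (𝓝 (-∫ x in rect a₁ c₁ a₂ c₂, g x * ψ x)) := by
    refine (tendsto_integral_of_dominated_convergence (fun x => |g x * ψ x|)
      (fun n => ?_) ?_ (fun n => ?_) ?_).neg
    · exact (integrable_mul_of_continuous ((hχs n).continuous.mul hψ.continuous)
        g).aestronglyMeasurable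
    · exact (integrable_mul_of_continuous hψ.continuous g).abs
    · refine Eventually.of_forall fun x => ?_
      rw [Real.norm_eq_abs, abs_mul, abs_mul (χ n x), abs_mul (g x) (ψ x)]
      exact mul_le_mul_of_nonneg_left (mul_le_of_le_one_left (abs_nonneg _) (hχ1 n x))
        (abs_nonneg _)
    · filter_upwards [ae_restrict_mem isOpen_rect.measurableSet] with x hx
      refine tendsto_const_nhds.congr' ?_
      filter_upwards [hlarge x hx] with n hn
      simp only [hχ, cutoff_of_two_le hn.1.le, cutoff_of_two_le hn.2.le, one_mul]
  refine tendsto_nhds_unique lim1 (lim2.congr' ?_)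
  filter_upwards [eventually_ge_atTop 1] with n hn
  exact (h _ (htest n hn)).symm

/-- The product of the distances to the end points of an interval. -/
def endDist (a c x : ℝ) : ℝ := (x - a) * (c - x)

theorem contDiff_endDist (a c : ℝ) {n : WithTop ℕ∞} : ContDiff ℝ n (endDist a c) := by
  unfold endDist; fun_prop

theorem endDist_pos_iff {a c : ℝ} (hac : a < c) (x : ℝ) : 0 < endDist a c x ↔ x ∈ Ioo a c := by
  constructor
  · intro h
    rcases pos_and_pos_or_neg_and_neg_of_mul_pos h with h | h
    · exact ⟨by linarith [h.1], by linarith [h.2]⟩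
    · linarith [h.1, h.2]
  · rintro ⟨h1, h2⟩
    exact mul_pos (by linarith) (by linarith)

theorem IsWeakPartial.integral_mul_zero (h₁ : a₁ < c₁) (h₂ : a₂ < c₂)
    {u g : L2 (rect a₁ c₁ a₂ c₂)} (h : IsWeakPartial 0 u g) {ψ : ℝ × ℝ → ℝ}
    (hψ : ContDiff ℝ ((⊤ : ℕ∞) : WithTop ℕ∞) ψ) {C : ℝ}
    (hC : ∀ x ∈ rect a₁ c₁ a₂ c₂, |ψ x| ≤ C * endDist a₁ c₁ x.1) :
    ∫ x in rect a₁ c₁ a₂ c₂, u x * partialDeriv 0 ψ x = -∫ x in rect a₁ c₁ a₂ c₂, g x * ψ x := by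
  refine h.integral_mul hψ (D := fun x => endDist a₁ c₁ x.1) (D' := fun x => endDist a₂ c₂ x.2)
    ((contDiff_endDist a₁ c₁).comp contDiff_fst) ((contDiff_endDist a₂ c₂).comp contDiff_snd)
    (fun x => ?_) (fun x => ?_) hC
  · rw [endDist_pos_iff h₁, endDist_pos_iff h₂]; rfl
  · have := partialDeriv_zero_prod (x := x) (hasDerivAt_const x.1 (1 : ℝ))
      ((contDiff_endDist a₂ c₂ (n := 1)).differentiable (by simp) x.2)
    simpa using this

theorem IsWeakPartial.integral_mul_one (h₁ : a₁ < c₁) (h₂ : a₂ < c₂)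
    {u g : L2 (rect a₁ c₁ a₂ c₂)} (h : IsWeakPartial 1 u g) {ψ : ℝ × ℝ → ℝ}
    (hψ : ContDiff ℝ ((⊤ : ℕ∞) : WithTop ℕ∞) ψ) {C : ℝ}
    (hC : ∀ x ∈ rect a₁ c₁ a₂ c₂, |ψ x| ≤ C * endDist a₂ c₂ x.2) :
    ∫ x in rect a₁ c₁ a₂ c₂, u x * partialDeriv 1 ψ x = -∫ x in rect a₁ c₁ a₂ c₂, g x * ψ x := by
  refine h.integral_mul hψ (D := fun x => endDist a₂ c₂ x.2) (D' := fun x => endDist a₁ c₁ x.1)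
    ((contDiff_endDist a₂ c₂).comp contDiff_snd) ((contDiff_endDist a₁ c₁).comp contDiff_fst)
    (fun x => ?_) (fun x => ?_) hC
  · rw [endDist_pos_iff h₁, endDist_pos_iff h₂, and_comm]; rfl
  · have := partialDeriv_one_prod (x := x)
      ((contDiff_endDist a₁ c₁ (n := 1)).differentiable (by simp) x.1)
      (hasDerivAt_const x.2 (1 : ℝ))
    simpa using this

end IntegrationByParts

/-! ### The Hilbert space H¹ -/

section Sobolev

/-- The embedding `H¹(Ω) → L²(Ω)` as a bounded operator. -/
def toL2L (Ω : Set (ℝ × ℝ)) : H1 Ω →L[ℝ] L2 Ω :=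
  (PiLp.proj 2 (fun _ : Fin 3 => L2 Ω) 0).comp (H1 Ω).subtypeL

theorem inner_H1 {Ω : Set (ℝ × ℝ)} (U V : H1 Ω) : inner ℝ U V =
    inner ℝ (toL2 U) (toL2 V) + ∑ k : Fin 2, inner ℝ (weakGrad U k) (weakGrad V k) := by
  rw [Submodule.coe_inner, PiLp.inner_apply, Fin.sum_univ_succ]
  rfl

variable {a₁ c₁ a₂ c₂ : ℝ}

theorem isWeakPartial_iff_inner {k : Fin 2} {u g : L2 (rect a₁ c₁ a₂ c₂)} :
    IsWeakPartial k u g ↔ ∀ φ (hφ : IsTest (rect a₁ c₁ a₂ c₂) φ),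
      inner ℝ (contL2 a₁ c₁ a₂ c₂ _ (hφ.continuous_partialDeriv k)) u =
        - inner ℝ (contL2 a₁ c₁ a₂ c₂ _ hφ.smooth.continuous) g := by
  simp only [inner_contL2]
  rfl

/-- Each weak derivative identity is an equation between continuous functionals of the triple, so H¹
is an intersection of closed sets; this gives its completeness. -/
theorem isClosed_H1 : IsClosed (H1 (rect a₁ c₁ a₂ c₂) :
    Set (PiLp 2 (fun _ : Fin 3 => L2 (rect a₁ c₁ a₂ c₂)))) := by
  have : (H1 (rect a₁ c₁ a₂ c₂) : Set (PiLp 2 (fun _ : Fin 3 => L2 (rect a₁ c₁ a₂ c₂)))) =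
      ⋂ k : Fin 2, ⋂ φ, ⋂ hφ : IsTest (rect a₁ c₁ a₂ c₂) φ,
        {U | inner ℝ (contL2 a₁ c₁ a₂ c₂ _ (hφ.continuous_partialDeriv k)) (U 0) =
          - inner ℝ (contL2 a₁ c₁ a₂ c₂ _ hφ.smooth.continuous) (U k.succ)} := by
    ext U
    simp only [mem_iInter]
    exact forall_congr' fun k => isWeakPartial_iff_inner
  rw [this]
  refine isClosed_iInter fun k => isClosed_iInter fun φ => isClosed_iInter fun hφ =>
    isClosed_eq ?_ ?_
  · exact continuous_const.inner (PiLp.proj (𝕜 := ℝ) 2 (fun _ : Fin 3 => L2 (rect a₁ c₁ a₂ c₂)) 0).continuous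
  · exact (continuous_const.inner
      (PiLp.proj (𝕜 := ℝ) 2 (fun _ : Fin 3 => L2 (rect a₁ c₁ a₂ c₂)) k.succ).continuous).neg

instance completeSpace_H1 : CompleteSpace (H1 (rect a₁ c₁ a₂ c₂)) :=
  isClosed_H1.completeSpace_coe

/-- If the function vanishes, its weak gradient is orthogonal to all test functions and vanishes
too. -/
theorem eq_zero_of_toL2_eq_zero {U : H1 (rect a₁ c₁ a₂ c₂)} (h : toL2 U = 0) : U = 0 := by
  have hg : ∀ k : Fin 2, weakGrad U k = 0 := fun k => by
    refine eq_zero_of_integral_test fun φ hφ => ?_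
    have h1 := (isWeakPartial_iff_inner.1 (U.2 k)) φ hφ
    change inner ℝ _ (toL2 U) = - inner ℝ _ (weakGrad U k) at h1
    rw [h, inner_zero_right, inner_contL2] at h1
    linarith
  apply Subtype.ext
  ext1 k
  refine Fin.cases h (fun k => hg k) k

/-- The element of `H¹` given by a function that is smooth on the plane. -/
def smoothH1 (a₁ c₁ a₂ c₂ : ℝ) (P : ℝ × ℝ → ℝ) (hP : ContDiff ℝ 1 P) : H1 (rect a₁ c₁ a₂ c₂) :=
  ⟨WithLp.toLp 2 (Fin.cases (contL2 a₁ c₁ a₂ c₂ P hP.continuous)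
    fun k => contL2 a₁ c₁ a₂ c₂ (partialDeriv k P) (continuous_partialDeriv hP k)), by
    intro k φ hφ
    change ∫ x in rect a₁ c₁ a₂ c₂, contL2 a₁ c₁ a₂ c₂ P hP.continuous x * partialDeriv k φ x =
      -∫ x in rect a₁ c₁ a₂ c₂,
        contL2 a₁ c₁ a₂ c₂ (partialDeriv k P) (continuous_partialDeriv hP k) x * φ x
    have e1 : ∫ x in rect a₁ c₁ a₂ c₂, contL2 a₁ c₁ a₂ c₂ P hP.continuous x * partialDeriv k φ x
        = ∫ x, P x * partialDeriv k φ x := by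
      refine Eq.trans (integral_congr_ae ?_)
        (setIntegral_eq_integral_of_forall_compl_eq_zero (s := rect a₁ c₁ a₂ c₂) ?_)
      · filter_upwards [contL2_ae hP.continuous] with x hx
        rw [hx]
      · intro x hx
        have : fderiv ℝ φ x = 0 := image_eq_zero_of_notMem_tsupport
          fun h' => hx (hφ.support (tsupport_fderiv_subset ℝ h'))
        simp [partialDeriv, this]
    have e2 : ∫ x in rect a₁ c₁ a₂ c₂,
        contL2 a₁ c₁ a₂ c₂ (partialDeriv k P) (continuous_partialDeriv hP k) x * φ x
        = ∫ x, partialDeriv k P x * φ x := by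
      refine Eq.trans (integral_congr_ae ?_)
        (setIntegral_eq_integral_of_forall_compl_eq_zero (s := rect a₁ c₁ a₂ c₂) ?_)
      · filter_upwards [contL2_ae (continuous_partialDeriv hP k)] with x hx
        rw [hx]
      · intro x hx
        rw [image_eq_zero_of_notMem_tsupport fun h' => hx (hφ.support h'), mul_zero]
    rw [e1, e2]
    have hφ1 : ContDiff ℝ 1 φ := hφ.smooth.of_le (by exact_mod_cast le_top)
    -- The compact support of `φ` allows classical integration by parts on the whole plane, without
    -- boundary terms.
    refine integral_mul_fderiv_eq_neg_fderiv_mul_of_integrable ?_ ?_ ?_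
      (fun x _ => hP.differentiable (by simp) x) (fun x _ => hφ1.differentiable (by simp) x)
    · exact ((continuous_partialDeriv hP k).mul hφ1.continuous).integrable_of_hasCompactSupport
        hφ.compact.mul_left
    · exact (hP.continuous.mul (continuous_partialDeriv hφ1 k)).integrable_of_hasCompactSupport
        (hφ.compact_partialDeriv k).mul_left
    · exact (hP.continuous.mul hφ1.continuous).integrable_of_hasCompactSupport
        hφ.compact.mul_left⟩

theorem weakGrad_smoothH1 {P : ℝ × ℝ → ℝ} (hP : ContDiff ℝ 1 P) (k : Fin 2) :
    weakGrad (smoothH1 a₁ c₁ a₂ c₂ P hP) k =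
      contL2 a₁ c₁ a₂ c₂ (partialDeriv k P) (continuous_partialDeriv hP k) := rfl

end Sobolev

/-! ### The modes in H¹ and the variational Laplacian -/

section Modes

/-- The normalised derivative of a Neumann mode of an interval, up to the factor `-freq`. -/
def unitSin (a c : ℝ) (i : ℕ) (x : ℝ) : ℝ :=
  (√(cosNormSq a c i))⁻¹ * Real.sin (freq a c i * (x - a))

theorem contDiff_unitSin (a c : ℝ) (i : ℕ) {n : WithTop ℕ∞} : ContDiff ℝ n (unitSin a c i) := by
  unfold unitSin; fun_prop

theorem hasDerivAt_unitCos (a c : ℝ) (i : ℕ) (x : ℝ) :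
    HasDerivAt (unitCos a c i) (-freq a c i * unitSin a c i x) x := by
  have h := ((((hasDerivAt_id x).sub_const a).const_mul (freq a c i)).cos).const_mul
    (√(cosNormSq a c i))⁻¹
  refine h.congr_deriv ?_
  simp only [id, unitSin]
  ring

theorem hasDerivAt_unitSin (a c : ℝ) (i : ℕ) (x : ℝ) :
    HasDerivAt (unitSin a c i) (freq a c i * unitCos a c i x) x := by
  have h := ((((hasDerivAt_id x).sub_const a).const_mul (freq a c i)).sin).const_mul
    (√(cosNormSq a c i))⁻¹
  refine h.congr_deriv ?_
  simp only [id, unitCos, cosMode]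
  ring

/-- The sine vanishes at both ends, so it is bounded by freq · (x − a) and by freq · (c − x).
Weighting these bounds with c − x and x − a and adding gives (c − a)|sin| ≤ 2 freq (x − a)(c − x).
-/
theorem exists_abs_unitSin_le {a c : ℝ} (hac : a < c) (i : ℕ) :
    ∃ C, 0 ≤ C ∧ ∀ x ∈ Ioo a c, |unitSin a c i x| ≤ C * endDist a c x := by
  have hl : 0 < c - a := by linarith
  have hp := Real.pi_pos
  have hf : 0 ≤ freq a c i := by unfold freq; positivity
  refine ⟨(√(cosNormSq a c i))⁻¹ * (2 * freq a c i / (c - a)), by positivity, fun x hx => ?_⟩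
  rw [unitSin, abs_mul, abs_of_nonneg (inv_nonneg.2 (Real.sqrt_nonneg _)), mul_assoc]
  refine mul_le_mul_of_nonneg_left ?_ (by positivity)
  set s := Real.sin (freq a c i * (x - a)) with hs
  have hxa : 0 < x - a := by linarith [hx.1]
  have hcx : 0 < c - x := by linarith [hx.2]
  have h1 : |s| ≤ freq a c i * (x - a) := by
    have := Real.abs_sin_le_abs (x := freq a c i * (x - a))
    rwa [abs_of_nonneg (mul_nonneg hf hxa.le)] at this
  have h2 : |s| ≤ freq a c i * (c - x) := by
    have e : freq a c i * (x - a) = i * Real.pi - freq a c i * (c - x) := by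
      unfold freq; field_simp; ring
    rw [hs, e, Real.sin_nat_mul_pi_sub, abs_neg, abs_mul, abs_pow, abs_neg, abs_one, one_pow,
      one_mul]
    have := Real.abs_sin_le_abs (x := freq a c i * (c - x))
    rwa [abs_of_nonneg (mul_nonneg hf hcx.le)] at this
  rw [endDist, div_mul_eq_mul_div, le_div_iff₀ hl]
  nlinarith [mul_le_mul_of_nonneg_right h1 hcx.le, mul_le_mul_of_nonneg_right h2 hxa.le]

variable {a₁ c₁ a₂ c₂ : ℝ}

theorem partialDeriv_zero_mode (p : ℕ × ℕ) (x : ℝ × ℝ) :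
    partialDeriv 0 (mode a₁ c₁ a₂ c₂ p) x =
      -freq a₁ c₁ p.1 * (unitSin a₁ c₁ p.1 x.1 * unitCos a₂ c₂ p.2 x.2) := by
  rw [← mul_assoc]
  exact partialDeriv_zero_prod (hasDerivAt_unitCos a₁ c₁ p.1 x.1)
    (hasDerivAt_unitCos a₂ c₂ p.2 x.2).differentiableAt

theorem partialDeriv_one_mode (p : ℕ × ℕ) (x : ℝ × ℝ) :
    partialDeriv 1 (mode a₁ c₁ a₂ c₂ p) x =
      -freq a₂ c₂ p.2 * (unitCos a₁ c₁ p.1 x.1 * unitSin a₂ c₂ p.2 x.2) := by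
  rw [mul_left_comm]
  exact partialDeriv_one_prod (hasDerivAt_unitCos a₁ c₁ p.1 x.1).differentiableAt
    (hasDerivAt_unitCos a₂ c₂ p.2 x.2)

/-- The Neumann modes as elements of `H¹`. -/
def modeH1 (a₁ c₁ a₂ c₂ : ℝ) (p : ℕ × ℕ) : H1 (rect a₁ c₁ a₂ c₂) :=
  smoothH1 a₁ c₁ a₂ c₂ (mode a₁ c₁ a₂ c₂ p) (contDiff_mode a₁ c₁ a₂ c₂ p)

theorem toL2_modeH1 (p : ℕ × ℕ) : toL2 (modeH1 a₁ c₁ a₂ c₂ p) = modeL2 a₁ c₁ a₂ c₂ p := rfl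

/-- The normal derivative of a mode is a sine that vanishes on the faces, so integration by parts is
allowed against every Φ in H¹, whatever its boundary values: this is the Neumann condition. -/
theorem inner_weakGrad_modeH1_zero (h₁ : a₁ < c₁) (h₂ : a₂ < c₂) (p : ℕ × ℕ)
    (Φ : H1 (rect a₁ c₁ a₂ c₂)) :
    inner ℝ (weakGrad (modeH1 a₁ c₁ a₂ c₂ p) 0) (weakGrad Φ 0) =
      freq a₁ c₁ p.1 ^ 2 * inner ℝ (modeL2 a₁ c₁ a₂ c₂ p) (toL2 Φ) := by
  obtain ⟨C, -, hC⟩ := exists_abs_unitSin_le h₁ p.1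
  have hw : IsWeakPartial 0 (toL2 Φ) (weakGrad Φ 0) := Φ.2 0
  have h := hw.integral_mul_zero h₁ h₂
    (ψ := fun x => unitSin a₁ c₁ p.1 x.1 * unitCos a₂ c₂ p.2 x.2)
    (((contDiff_unitSin a₁ c₁ p.1).comp contDiff_fst).mul
      ((contDiff_unitCos a₂ c₂ p.2).comp contDiff_snd)) (C := C * (√((c₂ - a₂) / 2))⁻¹)
    (fun x hx => by
      have := mul_le_mul (hC x.1 hx.1) (abs_unitCos_le h₂ p.2 x.2) (abs_nonneg _)
        ((abs_nonneg _).trans (hC x.1 hx.1))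
      rw [abs_mul]
      refine this.trans_eq ?_
      ring)
  have e1 : ∀ x : ℝ × ℝ, partialDeriv 0
      (fun x => unitSin a₁ c₁ p.1 x.1 * unitCos a₂ c₂ p.2 x.2) x
        = freq a₁ c₁ p.1 * mode a₁ c₁ a₂ c₂ p x := fun x => by
    rw [mode, ← mul_assoc]
    exact partialDeriv_zero_prod (hasDerivAt_unitSin a₁ c₁ p.1 x.1)
      (hasDerivAt_unitCos a₂ c₂ p.2 x.2).differentiableAt
  simp only [e1, mul_left_comm _ (freq a₁ c₁ p.1)] at h
  rw [integral_const_mul] at h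
  rw [modeH1, weakGrad_smoothH1, inner_contL2, modeL2, inner_contL2]
  simp only [partialDeriv_zero_mode, mul_left_comm _ (-freq a₁ c₁ p.1)]
  rw [integral_const_mul, sq, mul_assoc, h]
  ring

theorem inner_weakGrad_modeH1_one (h₁ : a₁ < c₁) (h₂ : a₂ < c₂) (p : ℕ × ℕ)
    (Φ : H1 (rect a₁ c₁ a₂ c₂)) :
    inner ℝ (weakGrad (modeH1 a₁ c₁ a₂ c₂ p) 1) (weakGrad Φ 1) =
      freq a₂ c₂ p.2 ^ 2 * inner ℝ (modeL2 a₁ c₁ a₂ c₂ p) (toL2 Φ) := by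
  obtain ⟨C, hC0, hC⟩ := exists_abs_unitSin_le h₂ p.2
  have hw : IsWeakPartial 1 (toL2 Φ) (weakGrad Φ 1) := Φ.2 1
  have h := hw.integral_mul_one h₁ h₂
    (ψ := fun x => unitCos a₁ c₁ p.1 x.1 * unitSin a₂ c₂ p.2 x.2)
    (((contDiff_unitCos a₁ c₁ p.1).comp contDiff_fst).mul
      ((contDiff_unitSin a₂ c₂ p.2).comp contDiff_snd)) (C := (√((c₁ - a₁) / 2))⁻¹ * C)
    (fun x hx => by
      have := mul_le_mul (abs_unitCos_le h₁ p.1 x.1) (hC x.2 hx.2) (abs_nonneg _) (by positivity)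
      rw [abs_mul, mul_assoc]
      exact this)
  have e1 : ∀ x : ℝ × ℝ, partialDeriv 1
      (fun x => unitCos a₁ c₁ p.1 x.1 * unitSin a₂ c₂ p.2 x.2) x
        = freq a₂ c₂ p.2 * mode a₁ c₁ a₂ c₂ p x := fun x => by
    rw [mode, mul_left_comm]
    exact partialDeriv_one_prod (hasDerivAt_unitCos a₁ c₁ p.1 x.1).differentiableAt
      (hasDerivAt_unitSin a₂ c₂ p.2 x.2)
  simp only [e1, mul_left_comm _ (freq a₂ c₂ p.2)] at h
  rw [integral_const_mul] at h
  rw [modeH1, weakGrad_smoothH1, inner_contL2, modeL2, inner_contL2]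
  simp only [partialDeriv_one_mode, mul_left_comm _ (-freq a₂ c₂ p.2)]
  rw [integral_const_mul, sq, mul_assoc, h]
  ring

theorem sum_inner_weakGrad_modeH1 (h₁ : a₁ < c₁) (h₂ : a₂ < c₂) (p : ℕ × ℕ)
    (Φ : H1 (rect a₁ c₁ a₂ c₂)) :
    ∑ k : Fin 2, inner ℝ (weakGrad (modeH1 a₁ c₁ a₂ c₂ p) k) (weakGrad Φ k) =
      modeRate a₁ c₁ a₂ c₂ p * coord (modeBasis h₁ h₂) p (toL2 Φ) := by
  rw [Fin.sum_univ_two, inner_weakGrad_modeH1_zero h₁ h₂, inner_weakGrad_modeH1_one h₁ h₂,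
    coord_apply, coe_modeBasis, modeRate, add_mul]

/-- Pairing with a mode in H¹ is a multiple of pairing in L². This gives orthogonality and
completeness of the modes in H¹ from the facts in L². -/
theorem inner_modeH1 (h₁ : a₁ < c₁) (h₂ : a₂ < c₂) (p : ℕ × ℕ) (Φ : H1 (rect a₁ c₁ a₂ c₂)) :
    inner ℝ (modeH1 a₁ c₁ a₂ c₂ p) Φ =
      (1 + modeRate a₁ c₁ a₂ c₂ p) * coord (modeBasis h₁ h₂) p (toL2 Φ) := by
  rw [inner_H1, sum_inner_weakGrad_modeH1 h₁ h₂, toL2_modeH1, coord_apply, coe_modeBasis]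
  ring

/-- The ratio of the `H¹` norm to the `L²` norm of a Neumann mode. -/
def modeWeight (a₁ c₁ a₂ c₂ : ℝ) (p : ℕ × ℕ) : ℝ := √(1 + modeRate a₁ c₁ a₂ c₂ p)

theorem one_add_modeRate_pos (p : ℕ × ℕ) : 0 < 1 + modeRate a₁ c₁ a₂ c₂ p := by
  unfold modeRate; positivity

theorem modeWeight_pos (p : ℕ × ℕ) : 0 < modeWeight a₁ c₁ a₂ c₂ p :=
  Real.sqrt_pos.2 (one_add_modeRate_pos p)

theorem inner_unit_modeH1 (h₁ : a₁ < c₁) (h₂ : a₂ < c₂) (p : ℕ × ℕ)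
    (Φ : H1 (rect a₁ c₁ a₂ c₂)) :
    inner ℝ ((modeWeight a₁ c₁ a₂ c₂ p)⁻¹ • modeH1 a₁ c₁ a₂ c₂ p) Φ =
      modeWeight a₁ c₁ a₂ c₂ p * coord (modeBasis h₁ h₂) p (toL2 Φ) := by
  refine (real_inner_smul_left (modeH1 a₁ c₁ a₂ c₂ p) Φ _).trans ?_
  rw [inner_modeH1 h₁ h₂, ← mul_assoc]
  congr 1
  rw [inv_mul_eq_div, div_eq_iff (modeWeight_pos p).ne', modeWeight,
    Real.mul_self_sqrt (one_add_modeRate_pos p).le]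

theorem coord_modeBasis_modeL2 (h₁ : a₁ < c₁) (h₂ : a₂ < c₂) (p q : ℕ × ℕ) :
    coord (modeBasis h₁ h₂) p (modeL2 a₁ c₁ a₂ c₂ q) = if p = q then 1 else 0 := by
  rw [coord_apply, coe_modeBasis]
  exact orthonormal_iff_ite.1 (orthonormal_modeL2 h₁ h₂) p q

/-- The Neumann modes, suitably normalised, form a Hilbert basis of `H¹`. -/
def modeBasisH1 (h₁ : a₁ < c₁) (h₂ : a₂ < c₂) :
    HilbertBasis (ℕ × ℕ) ℝ (H1 (rect a₁ c₁ a₂ c₂)) :=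
  HilbertBasis.mkOfOrthogonalEqBot
    (v := fun p => (modeWeight a₁ c₁ a₂ c₂ p)⁻¹ • modeH1 a₁ c₁ a₂ c₂ p) (by
      rw [orthonormal_iff_ite]
      intro p q
      have e : toL2 ((modeWeight a₁ c₁ a₂ c₂ q)⁻¹ • modeH1 a₁ c₁ a₂ c₂ q)
          = (modeWeight a₁ c₁ a₂ c₂ q)⁻¹ • modeL2 a₁ c₁ a₂ c₂ q := rfl
      rw [inner_unit_modeH1 h₁ h₂, e, map_smul, coord_modeBasis_modeL2]
      split_ifs with h
      · subst h
        rw [smul_eq_mul, mul_one, mul_inv_cancel₀ (modeWeight_pos p).ne']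
      · rw [smul_zero, mul_zero]) <| by
    rw [Submodule.eq_bot_iff]
    intro U hU
    rw [Submodule.mem_orthogonal] at hU
    refine eq_zero_of_toL2_eq_zero (repr_ext (modeBasis h₁ h₂) fun p => ?_)
    have h := hU _ (Submodule.subset_span ⟨p, rfl⟩)
    rw [inner_unit_modeH1 h₁ h₂] at h
    rw [map_zero]
    exact (mul_eq_zero.1 h).resolve_left (modeWeight_pos p).ne'

theorem coe_modeBasisH1 (h₁ : a₁ < c₁) (h₂ : a₂ < c₂) (p : ℕ × ℕ) :
    modeBasisH1 h₁ h₂ p = (modeWeight a₁ c₁ a₂ c₂ p)⁻¹ • modeH1 a₁ c₁ a₂ c₂ p := by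
  rw [modeBasisH1, HilbertBasis.coe_mkOfOrthogonalEqBot]

/-- The Neumann Laplacian acts diagonally on the Fourier coefficients. -/
theorem isNeumannLaplacian_iff (h₁ : a₁ < c₁) (h₂ : a₂ < c₂) (U : H1 (rect a₁ c₁ a₂ c₂))
    (v : L2 (rect a₁ c₁ a₂ c₂)) : IsNeumannLaplacian U v ↔ ∀ p, coord (modeBasis h₁ h₂) p v =
      -modeRate a₁ c₁ a₂ c₂ p * coord (modeBasis h₁ h₂) p (toL2 U) := by
  have hsym : ∀ p, ∑ k : Fin 2, inner ℝ (weakGrad U k) (weakGrad (modeH1 a₁ c₁ a₂ c₂ p) k) =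
      modeRate a₁ c₁ a₂ c₂ p * coord (modeBasis h₁ h₂) p (toL2 U) := fun p => by
    rw [← sum_inner_weakGrad_modeH1 h₁ h₂]
    exact Finset.sum_congr rfl fun k _ => real_inner_comm _ _
  have hv : ∀ p, inner ℝ v (toL2 (modeH1 a₁ c₁ a₂ c₂ p)) = coord (modeBasis h₁ h₂) p v :=
    fun p => by rw [toL2_modeH1, real_inner_comm, coord_apply, coe_modeBasis]
  constructor
  · intro h p
    have hp := h (modeH1 a₁ c₁ a₂ c₂ p)
    rw [hsym, hv] at hp
    linarith
  · intro h
    -- `G` is the defect of the variational equation. Written as an H¹ product minus an L² product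
    -- it is visibly bounded, so it vanishes once it vanishes on the modes.
    set G : H1 (rect a₁ c₁ a₂ c₂) →L[ℝ] ℝ :=
      innerSL ℝ U - (innerSL ℝ (toL2 U - v)).comp (toL2L _) with hG
    have hGapp : ∀ Φ, G Φ = ∑ k : Fin 2, inner ℝ (weakGrad U k) (weakGrad Φ k)
        + inner ℝ v (toL2 Φ) := fun Φ => by
      change inner ℝ U Φ - inner ℝ (toL2 U - v) (toL2 Φ) = _
      rw [inner_H1, inner_sub_left]
      ring
    have hG0 : G = 0 := by
      refine ContinuousLinearMap.ext_on (s := range (modeBasisH1 h₁ h₂)) ?_ ?_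
      · rw [Submodule.dense_iff_topologicalClosure_eq_top]
        exact (modeBasisH1 h₁ h₂).dense_span
      · rintro _ ⟨p, rfl⟩
        rw [coe_modeBasisH1, map_smul, hGapp, hsym, hv, h p]
        simp
    intro Φ
    have := hGapp Φ
    rw [hG0, zero_apply] at this
    linarith

theorem restrictH1_sub {ω Ω : Set (ℝ × ℝ)} (h : ω ⊆ Ω) (U V : H1 Ω) :
    restrictH1 h U - restrictH1 h V = restrictH1 h (U - V) := by
  apply Subtype.ext
  ext1 k
  apply Lp.ext
  change (restrictL2 h ((U : PiLp 2 (fun _ : Fin 3 => L2 Ω)) k)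
    - restrictL2 h ((V : PiLp 2 (fun _ : Fin 3 => L2 Ω)) k) : L2 ω) =ᵐ[_]
      restrictL2 h ((U : PiLp 2 (fun _ : Fin 3 => L2 Ω)) k
        - (V : PiLp 2 (fun _ : Fin 3 => L2 Ω)) k)
  have hmono : (volume : Measure (ℝ × ℝ)).restrict ω ≤ (volume : Measure (ℝ × ℝ)).restrict Ω :=
    Measure.restrict_mono h le_rfl
  filter_upwards [Lp.coeFn_sub (restrictL2 h ((U : PiLp 2 (fun _ : Fin 3 => L2 Ω)) k))
      (restrictL2 h ((V : PiLp 2 (fun _ : Fin 3 => L2 Ω)) k)),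
    restrictL2_ae h ((U : PiLp 2 (fun _ : Fin 3 => L2 Ω)) k),
    restrictL2_ae h ((V : PiLp 2 (fun _ : Fin 3 => L2 Ω)) k),
    restrictL2_ae h ((U : PiLp 2 (fun _ : Fin 3 => L2 Ω)) k
      - (V : PiLp 2 (fun _ : Fin 3 => L2 Ω)) k),
    (Measure.absolutelyContinuous_of_le hmono).ae_le
      (Lp.coeFn_sub ((U : PiLp 2 (fun _ : Fin 3 => L2 Ω)) k)
        ((V : PiLp 2 (fun _ : Fin 3 => L2 Ω)) k))] with x e1 e2 e3 e4 e5
  rw [e1, e4, e5, Pi.sub_apply, Pi.sub_apply, e2, e3]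

theorem norm_restrictL2_le {ω Ω : Set (ℝ × ℝ)} (h : ω ⊆ Ω) (u : L2 Ω) :
    ‖restrictL2 h u‖ ≤ ‖u‖ := by
  rw [Lp.norm_def, Lp.norm_def, eLpNorm_congr_ae (restrictL2_ae h u)]
  exact ENNReal.toReal_mono (Lp.eLpNorm_ne_top u)
    (eLpNorm_mono_measure _ (Measure.restrict_mono h le_rfl))

theorem norm_restrictH1_le {ω Ω : Set (ℝ × ℝ)} (h : ω ⊆ Ω) (U : H1 Ω) :
    ‖restrictH1 h U‖ ≤ ‖U‖ := by
  refine le_of_sq_le_sq ?_ (norm_nonneg _)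
  rw [Submodule.coe_norm, Submodule.coe_norm, PiLp.norm_sq_eq_of_L2, PiLp.norm_sq_eq_of_L2]
  exact Finset.sum_le_sum fun k _ => pow_le_pow_left₀ (norm_nonneg _) (norm_restrictL2_le h _) 2

end Modes

/-! ### The estimator on the rectangle -/

section Observer

variable {a₁ c₁ a₂ c₂ : ℝ}

theorem freq_sq_one_le {a c : ℝ} {i : ℕ} (hi : i ≠ 0) : freq a c 1 ^ 2 ≤ freq a c i ^ 2 := by
  have h : freq a c i = i * freq a c 1 := by unfold freq; push_cast; ring
  have hi' : (1 : ℝ) ≤ i := by exact_mod_cast Nat.one_le_iff_ne_zero.2 hi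
  rw [h, mul_pow]
  exact le_mul_of_one_le_left (sq_nonneg _) (one_le_pow₀ hi')

theorem freq_one_pos {a c : ℝ} (hac : a < c) : 0 < freq a c 1 := by
  have hl : 0 < c - a := by linarith
  have := Real.pi_pos
  unfold freq; positivity

/-- The Neumann heat equation on a rectangle with a point sensor, in modal form. -/
def rectSystem (h₁ : a₁ < c₁) (h₂ : a₂ < c₂) (b : ℝ × ℝ) :
    ModalSystem (ℕ × ℕ) (H1 (rect a₁ c₁ a₂ c₂)) (L2 (rect a₁ c₁ a₂ c₂)) where
  J := toL2L _
  e := modeBasis h₁ h₂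
  f := modeBasisH1 h₁ h₂
  weight := modeWeight a₁ c₁ a₂ c₂
  weight_pos := modeWeight_pos
  coord_f p U := by
    rw [coord_apply, coe_modeBasisH1, inner_unit_modeH1 h₁ h₂]; rfl
  rate := modeRate a₁ c₁ a₂ c₂
  zero := (0, 0)
  rate_zero := by simp [modeRate, freq]
  -- The smallest positive rate belongs to the first mode in one of the two directions.
  gap := min (freq a₁ c₁ 1 ^ 2) (freq a₂ c₂ 1 ^ 2) / 2
  gap_pos := by
    have := freq_one_pos h₁
    have := freq_one_pos h₂
    positivity
  gap_le p hp := by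
    rw [mul_div_cancel₀ _ two_ne_zero, modeRate]
    by_cases hp1 : p.1 = 0
    · have hp2 : p.2 ≠ 0 := fun h => hp (Prod.ext hp1 h)
      linarith [min_le_right (freq a₁ c₁ 1 ^ 2) (freq a₂ c₂ 1 ^ 2),
        freq_sq_one_le (a := a₂) (c := c₂) hp2, sq_nonneg (freq a₁ c₁ p.1)]
    · linarith [min_le_left (freq a₁ c₁ 1 ^ 2) (freq a₂ c₂ 1 ^ 2),
        freq_sq_one_le (a := a₁) (c := c₁) hp1, sq_nonneg (freq a₂ c₂ p.2)]
  summable_rate := summable_modeRate h₁ h₂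
  unstable := modeH1 a₁ c₁ a₂ c₂ (0, 0)
  J_unstable := by rw [coe_modeBasis]; rfl
  sensor p := mode a₁ c₁ a₂ c₂ p b
  bound := (√((c₁ - a₁) / 2))⁻¹ * (√((c₂ - a₂) / 2))⁻¹
  sensor_le p := abs_mode_le h₁ h₂ p b
  -- The unstable mode is a positive constant, so its output is nonzero wherever the sensor sits.
  sensor_zero := by
    have n1 := Real.sqrt_pos.2 (cosNormSq_pos h₁ 0)
    have n2 := Real.sqrt_pos.2 (cosNormSq_pos h₂ 0)
    simp only [mode, unitCos, cosMode_zero, mul_one]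
    positivity

/-- The gain of the estimator: output injection along the constant mode. -/
def observerGain (h₁ : a₁ < c₁) (h₂ : a₂ < c₂) (b : ℝ × ℝ) : ℝ →L[ℝ] H1 (rect a₁ c₁ a₂ c₂) :=
  (ContinuousLinearMap.id ℝ ℝ).smulRight
    ((rectSystem h₁ h₂ b).gain • (rectSystem h₁ h₂ b).unstable)

variable (h₁ : a₁ < c₁) (h₂ : a₂ < c₂) (b : ℝ × ℝ)

theorem toL2_observerGain (r : ℝ) : toL2 (observerGain h₁ h₂ b r) =
    ((rectSystem h₁ h₂ b).gain * r) • (rectSystem h₁ h₂ b).e (rectSystem h₁ h₂ b).zero := by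
  change (rectSystem h₁ h₂ b).J (r • (rectSystem h₁ h₂ b).gain • (rectSystem h₁ h₂ b).unstable) = _
  rw [map_smul, map_smul, ModalSystem.J_unstable, smul_smul, mul_comm]

theorem isNeumannLaplacian_iff_generates (U : H1 (rect a₁ c₁ a₂ c₂)) (v : L2 (rect a₁ c₁ a₂ c₂)) :
    IsNeumannLaplacian U v ↔ (rectSystem h₁ h₂ b).Generates (toL2 U) v :=
  isNeumannLaplacian_iff h₁ h₂ U v

theorem hasPointValue_output {U : H1 (rect a₁ c₁ a₂ c₂)} {v : L2 (rect a₁ c₁ a₂ c₂)}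
    (h : IsNeumannLaplacian U v) :
    HasPointValue (toL2 U) b ((rectSystem h₁ h₂ b).output (toL2 U)) :=
  hasPointValue_of_summable h₁ h₂ ((isNeumannLaplacian_iff_generates h₁ h₂ b U v).1 h).summable_coord b

variable {b} (hb : b ∈ closure (rect a₁ c₁ a₂ c₂))

-- Uniqueness of the point value on the closed rectangle identifies the sensor reading with the
-- output series, so the two descriptions of the operator agree, domains included.
include hb in
theorem estimatorGraph_iff (U V : H1 (rect a₁ c₁ a₂ c₂)) :
    estimatorGraph b (observerGain h₁ h₂ b) U V ↔
      (rectSystem h₁ h₂ b).EstimatorGenerates (toL2 U) (toL2 V) := by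
  constructor
  · rintro ⟨v, r, hv, hr, hV⟩
    rw [hr.unique hb (hasPointValue_output h₁ h₂ b hv), toL2_observerGain] at hV
    exact ⟨v, (isNeumannLaplacian_iff_generates h₁ h₂ b U v).1 hv, hV⟩
  · rintro ⟨v, hv, hV⟩
    have hv' := (isNeumannLaplacian_iff_generates h₁ h₂ b U v).2 hv
    refine ⟨v, _, hv', hasPointValue_output h₁ h₂ b hv', ?_⟩
    rw [toL2_observerGain]
    exact hV

theorem isSystemSolution_iff (z₀ : H1 (rect a₁ c₁ a₂ c₂)) (z : ℝ → H1 (rect a₁ c₁ a₂ c₂)) :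
    IsSystemSolution z₀ z ↔ (rectSystem h₁ h₂ b).IsFreeSolution z₀ z := by
  constructor
  · intro h
    refine ⟨h.cont, h.init, fun t ht => ?_⟩
    obtain ⟨v, hv, hd⟩ := h.eqn t ht
    exact ⟨v, (isNeumannLaplacian_iff_generates h₁ h₂ b _ v).1 hv, hd⟩
  · intro h
    refine ⟨h.cont, h.init, fun t ht => ?_⟩
    obtain ⟨v, hv, hd⟩ := h.eqn t ht
    exact ⟨v, (isNeumannLaplacian_iff_generates h₁ h₂ b _ v).2 hv, hd⟩

theorem toL2_sub {Ω : Set (ℝ × ℝ)} (U V : H1 Ω) : toL2 (U - V) = toL2 U - toL2 V := rfl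

include hb in
/-- The estimation error solves the homogeneous equation of the estimator. -/
theorem IsEstimatorSolution.isErrorSolution {z₀ w₀ : H1 (rect a₁ c₁ a₂ c₂)}
    {z w : ℝ → H1 (rect a₁ c₁ a₂ c₂)} (hz : IsSystemSolution z₀ z)
    (hw : IsEstimatorSolution b (observerGain h₁ h₂ b) z w₀ w) :
    (rectSystem h₁ h₂ b).IsErrorSolution (z₀ - w₀) (fun t => z t - w t) := by
  refine ⟨hz.cont.sub hw.cont, by rw [hz.init, hw.init], fun t ht => ?_⟩
  obtain ⟨vz, hvz, hdz⟩ := hz.eqn t ht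
  obtain ⟨vw, y, c, hvw, hy, hc, hdw⟩ := hw.eqn t ht
  have gz := (isNeumannLaplacian_iff_generates h₁ h₂ b _ _).1 hvz
  have gw := (isNeumannLaplacian_iff_generates h₁ h₂ b _ _).1 hvw
  -- Both readings are replaced by series on the domain, where the output is additive; the injection
  -- then depends on the error alone.
  rw [hy.unique hb (hasPointValue_output h₁ h₂ b hvz),
    hc.unique hb (hasPointValue_output h₁ h₂ b hvw),
    ← (rectSystem h₁ h₂ b).output_sub gz gw, toL2_observerGain, ← toL2_sub] at hdw
  refine ⟨_, ⟨vz - vw, gz.sub gw, rfl⟩, ?_⟩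
  refine (hdz.sub hdw).congr_deriv ?_
  exact sub_add_eq_sub_sub _ _ _

/-- Subtracting an error trajectory from the state gives a solution of the estimator. -/
theorem isEstimatorSolution_sub {z₀ w₀ : H1 (rect a₁ c₁ a₂ c₂)}
    {z ε : ℝ → H1 (rect a₁ c₁ a₂ c₂)} (hz : IsSystemSolution z₀ z)
    (hε : (rectSystem h₁ h₂ b).IsErrorSolution (z₀ - w₀) ε) :
    IsEstimatorSolution b (observerGain h₁ h₂ b) z w₀ (fun t => z t - ε t) := by
  refine ⟨hz.cont.sub hε.cont, by rw [hz.init, hε.init, sub_sub_cancel], fun t ht => ?_⟩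
  obtain ⟨vz, hvz, hdz⟩ := hz.eqn t ht
  obtain ⟨_, ⟨vε, gε, rfl⟩, hdε⟩ := hε.eqn t ht
  have gz := (isNeumannLaplacian_iff_generates h₁ h₂ b _ _).1 hvz
  have hw : IsNeumannLaplacian (z t - ε t) (vz - vε) :=
    (isNeumannLaplacian_iff_generates h₁ h₂ b _ _).2 (gz.sub gε)
  refine ⟨vz - vε, _, _, hw, hasPointValue_output h₁ h₂ b hvz, hasPointValue_output h₁ h₂ b hw, ?_⟩
  refine (hdz.sub hdε).congr_deriv ?_
  have e := (rectSystem h₁ h₂ b).output_sub gz gε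
  rw [toL2_observerGain, toL2_sub]
  change _ = _ + ((rectSystem h₁ h₂ b).gain * (_ - (rectSystem h₁ h₂ b).output
    (toL2 (z t) - (rectSystem h₁ h₂ b).J (ε t)))) • _
  rw [e, sub_sub_cancel]
  abel

-- The identity z(t) − w(t) = S(t)(z₀ − w₀), valid for every pair of solutions, gives both the
-- uniqueness of the estimator and the error bound.
include hb in
theorem isRegionalExpEstimator_observerGain {ω : Set (ℝ × ℝ)} (hω : ω ⊆ rect a₁ c₁ a₂ c₂) :
    IsRegionalExpEstimator hω b (observerGain h₁ h₂ b) := by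
  set M := rectSystem h₁ h₂ b with hM
  have herr : ∀ {z₀ w₀ : H1 (rect a₁ c₁ a₂ c₂)} {z w : ℝ → H1 (rect a₁ c₁ a₂ c₂)},
      IsSystemSolution z₀ z → IsEstimatorSolution b (observerGain h₁ h₂ b) z w₀ w →
      ∀ t, 0 ≤ t → z t - w t = M.estimatorFlow t (z₀ - w₀) := fun hz hw t ht =>
    (hw.isErrorSolution h₁ h₂ hb hz).eq_estimatorFlow ht
  refine ⟨⟨M.estimatorFlow, M.isC0Semigroup_estimatorFlow, fun U V => ?_,
    M.isExpStable_estimatorFlow⟩, fun U V hUV => ?_, fun z₀ => ?_, fun z₀ z hz w₀ => ?_, ?_⟩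
  · rw [estimatorGraph_iff h₁ h₂ hb]
    exact M.isGeneratedBy_estimatorFlow U V
  -- If ΔU lies in H¹, so does ΔU − 𝓗CU, because the gain takes values in H¹.
  · exact ⟨V - observerGain h₁ h₂ b (M.output (toL2 U)), toL2 V, _, hUV,
      hasPointValue_output h₁ h₂ b hUV, rfl⟩
  · refine ⟨_, (isSystemSolution_iff h₁ h₂ (b := b) _ _).2 (M.isFreeSolution_expDiag z₀),
      fun z' hz' t ht => ?_⟩
    exact ((isSystemSolution_iff h₁ h₂ (b := b) _ _).1 hz').eq_expDiag ht
  · have hw := isEstimatorSolution_sub h₁ h₂ hz (M.isErrorSolution_estimatorFlow (z₀ - w₀))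
    refine ⟨_, hw, fun w' hw' t ht => ?_⟩
    exact sub_right_injective ((herr hz hw' t ht).trans (herr hz hw t ht).symm)
  · obtain ⟨F, σ, hF, hσ, hS⟩ := M.isExpStable_estimatorFlow
    refine ⟨F, σ, hF, hσ, fun z₀ w₀ z w hz hw t ht => ?_⟩
    rw [restrictH1_sub, herr hz hw t ht]
    refine (norm_restrictH1_le hω _).trans ((M.estimatorFlow t).le_of_opNorm_le (hS t ht) _)

end Observer

end NeumannSensor

end

theorem proposition4p6
    (a₁ c₁ a₂ c₂ α₁ β₁ α₂ β₂ : ℝ) (hαβ₁ : α₁ < β₁) (hαβ₂ : α₂ < β₂)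
    (hω : NeumannSensor.rect α₁ β₁ α₂ β₂ ⊆ NeumannSensor.rect a₁ c₁ a₂ c₂)
    (b : ℝ × ℝ) (hb : b ∈ frontier (NeumannSensor.rect a₁ c₁ a₂ c₂))
    (J : ℕ) (hJ : J = NeumannSensor.unstableModes (c₁ - a₁) (c₂ - a₂))
    (hb₁ : ∀ i : ℕ, 1 ≤ i → i ≤ J →
      ¬ NeumannSensor.IsEvenInteger ((i : ℝ) * (b.1 - α₁) / (β₁ - α₁)))
    (hb₂ : ∀ j : ℕ, 1 ≤ j → j ≤ J →
      ¬ NeumannSensor.IsEvenInteger ((j : ℝ) * (b.2 - α₂) / (β₂ - α₂))) :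
    NeumannSensor.IsRegionalExpObservable hω b := by
  -- A point of the nonempty subregion lies in the rectangle, whose sides therefore have positive
  -- length.
  obtain ⟨x, hx⟩ := exists_between hαβ₁
  obtain ⟨y, hy⟩ := exists_between hαβ₂
  have hmem : (x, y) ∈ NeumannSensor.rect a₁ c₁ a₂ c₂ := hω ⟨hx, hy⟩
  have h₁ : a₁ < c₁ := hmem.1.1.trans hmem.1.2
  have h₂ : a₂ < c₂ := hmem.2.1.trans hmem.2.2
  exact ⟨_, NeumannSensor.isRegionalExpEstimator_observerGain h₁ h₂ (frontier_subset_closure hb) hω⟩
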